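/- For a finite index set $I$, let $\mathsf{AC^0}[s,d]$ be the set of functions $\{0,1\}^I\to\{0,1\}$ computed by Boolean circuits (directed acyclic graphs) built from unbounded-fan-in AND and OR gates and NOT gates, of size at most $s$ and depth at most $d$. Here the size is the number of AND and OR gates, and the depth is the largest number of AND and OR gates on a path to the output; NOT gates count towards neither. (A bound for this notion of size holds a fortiori if NOT gates, inputs or wires are counted as well.) There is an absolute constant $C>0$ such that the following holds for all integers $s\ge 2$, $d\ge 1$, $K\ge 1$, $M\ge 0$. Let $f:\{0,1\}^{K\times M}\to\{0,1\}$ be in $\mathsf{AC^0}[s,d]$ and let $\mathcal D$ be any probability distribution on $\{0,1\}^M$. Let $x\sim\mathcal D^K$ be a $K\times M$ Boolean matrix whose rows are drawn independently from $\mathcal D$. Given $x$, let $y$ be the matrix obtained from $x$ by choosing one of the $K$ rows uniformly at random, replacing it with a fresh independent sample from $\mathcal D$, and leaving the other rows unchanged. Then for every real $p>0$, \[ \Pr_{x\sim\mathcal D^K}\Bigl[\Pr_{y}\bigl[f(x)\ne f(y)\bigr]\ge p\Bigr]\;\le\;\frac{4K}{p}\cdot 2^{-\,pK/(C\log_2 s)^{d-1}}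 . \] -/

import Mathlib

open MeasureTheory

/-- A gate that may read the input bits (indexed by `ι`) and `g` previously computed gates.
AND and OR gates have unbounded fan-in; the empty AND is true and the empty OR is false. -/
inductive Gate (ι : Type) (g : ℕ) : Type
  | and (S : Finset (ι ⊕ Fin g)) : Gate ι g
  | or (S : Finset (ι ⊕ Fin g)) : Gate ι g
  | not (a : ι ⊕ Fin g) : Gate ι g

namespace Gate

/-- The value of a gate, given the values of all the nodes that it may read. -/
def eval {ι : Type} {g : ℕ} (v : ι ⊕ Fin g → Bool) : Gate ι g → Bool
  | .and S => decide (∀ a ∈ S, v a = true)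
  | .or S => decide (∃ a ∈ S, v a = true)
  | .not a => !(v a)

/-- The depth of a gate, given the depths of all the nodes that it may read:
AND and OR gates contribute one, NOT gates contribute nothing. -/
def depth {ι : Type} {g : ℕ} (h : ι ⊕ Fin g → ℕ) : Gate ι g → ℕ
  | .and S => S.sup h + 1
  | .or S => S.sup h + 1
  | .not a => h a

/-- The contribution of a gate to the size of a circuit: AND and OR gates are counted,
NOT gates are free. -/
def size {ι : Type} {g : ℕ} : Gate ι g → ℕ
  | .and _ => 1
  | .or _ => 1
  | .not _ => 0

end Gate

/-- A list of `g` gates in topological order: every gate reads input bits and earlier gates.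
Gates may be reused, so that this is a directed acyclic graph and not only a formula. -/
inductive GateList (ι : Type) : ℕ → Type
  | nil : GateList ι 0
  | snoc {g : ℕ} (P : GateList ι g) (a : Gate ι g) : GateList ι (g + 1)

namespace GateList

/-- The values of the gates on the input `x`. -/
def val {ι : Type} (x : ι → Bool) : {g : ℕ} → GateList ι g → Fin g → Bool
  | _, .nil => Fin.elim0
  | _, .snoc P a => Fin.snoc (α := fun _ => Bool) (P.val x) (a.eval (Sum.elim x (P.val x)))

/-- The depths of the gates; input bits have depth zero. -/
def depth {ι : Type} : {g : ℕ} → GateList ι g → Fin g → ℕ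
  | _, .nil => Fin.elim0
  | _, .snoc P a =>
      Fin.snoc (α := fun _ => ℕ) P.depth (a.depth (Sum.elim (fun _ => 0) P.depth))

/-- The number of AND and OR gates. -/
def size {ι : Type} : {g : ℕ} → GateList ι g → ℕ
  | _, .nil => 0
  | _, .snoc P a => P.size + a.size

end GateList

/-- A Boolean circuit with input bits indexed by `ι`, unbounded fan-in AND and OR gates and
NOT gates, and one output node (a gate or an input bit). -/
structure BoolCircuit (ι : Type) where
  numGates : ℕ
  gates : GateList ι numGates
  output : ι ⊕ Fin numGates

namespace BoolCircuit

/-- The Boolean function computed by a circuit. -/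
def eval {ι : Type} (c : BoolCircuit ι) (x : ι → Bool) : Bool :=
  Sum.elim x (c.gates.val x) c.output

/-- The largest number of AND and OR gates on a path from a source to the output. -/
def depth {ι : Type} (c : BoolCircuit ι) : ℕ :=
  Sum.elim (fun _ => 0) c.gates.depth c.output

/-- The number of AND and OR gates. -/
def size {ι : Type} (c : BoolCircuit ι) : ℕ := c.gates.size

end BoolCircuit

/-- `AC0 ι s d`: the Boolean functions on `{0,1}^ι` computed by a circuit of size at most `s`
and depth at most `d`. -/
def AC0 (ι : Type) (s d : ℕ) : Set ((ι → Bool) → Bool) :=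
  {f | ∃ c : BoolCircuit ι, c.size ≤ s ∧ c.depth ≤ d ∧ ∀ x, f x = c.eval x}

/-- The law `D^K` of a `K × M` Boolean matrix with independent rows of law `D`. -/
noncomputable def rowsLaw (K : ℕ) {M : ℕ} (D : PMF (Fin M → Bool)) :
    Measure (Fin K → Fin M → Bool) :=
  Measure.pi fun _ => D.toMeasure

/-- The law of the matrix obtained from `x` by replacing a uniformly random row by a fresh
sample from `D`. -/
noncomputable def resampleRow {K M : ℕ} [NeZero K] (D : PMF (Fin M → Bool))
    (x : Fin K → Fin M → Bool) : PMF (Fin K → Fin M → Bool) :=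
  (PMF.uniformOfFintype (Fin K)).bind fun i => D.map fun w => Function.update x i w

set_option linter.unusedSectionVars false

/-! The proof passes to the Boolean cube by symmetrization. For independent matrices a and b and z
in {0,1}^K, the swapped pair (`mix z a b`, `mix z b a`) has the law of (a, b), and the rows i for
which replacing a_i by b_i changes f become the coordinates at which z ↦ f(mix z a b) is sensitive
(`sum_mix`, `changeSet_mix`). This function of z is computed by the same circuit, each input now
depending on one bit of z. It therefore suffices to bound the average of (1+Q)^sensitivity over the
cube by 4, where Q = (2048 log₂ s)^{-(d-1)}. Jensen's inequality in b, Markov's inequality in a and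
2^Q ≤ 1+Q then give the tail.

The moment bound is a switching lemma. A random set S of live coordinates, each live independently
with probability Q', comes with unambiguous certificates relative to the values off S. Every live
sensitive coordinate lies in the certificate, and the mean of 2^|S ∩ sens| is (1+Q')^|sens|, so it
is enough to control 2^(live part of a certificate). For the induction over layers this is
strengthened to adaptive strategies that examine many functions in turn, each step being discounted
by 1/4 (`StrategyBound`).

For a layer of disjunctions, the canonical evaluator repeatedly examines a witness for the first
disjunct not yet refuted. After thinning S with probability q, the input is encoded by writing the
witness values onto the surviving examined coordinates; the first true disjunct of the encoded input
is then the one to examine. A code records which examined coordinates survived and their true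
values. The decoder is a strategy for the layer below that sees the whole input (`simulate_spec`),
and a weighted count turns its bound into the new one (`strategyBound_disj`). Its choices are
removed by guessing among |I|+1 possibilities per step, which costs a power θ of order 1/log s
(`selBound_of_strategyBound`) and so a factor of order log s in the rate per layer. -/

section Switching

/-! ### First elements, adaptive strategies and certificates. -/

open scoped Classical in
/-- The first element of a set in a fixed well-order of the ambient type. -/
noncomputable def firstElem {α : Type} (T : Set α) : Option α :=
  if hT : T.Nonempty then some (WellFounded.min (WellOrderingRel.isWellOrder (α := α)).wf T hT)
  else none

theorem firstElem_eq_none {α : Type} {T : Set α} : firstElem T = none ↔ T = ∅ := by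
  unfold firstElem
  split_ifs with h
  · simp [h.ne_empty]
  · simpa [Set.not_nonempty_iff_eq_empty] using h

theorem firstElem_mem {α : Type} {T : Set α} {a : α} (h : firstElem T = some a) : a ∈ T := by
  unfold firstElem at h
  split_ifs at h with hT
  · obtain rfl := Option.some.inj h
    exact WellFounded.min_mem _ _ _

/-- Used to compare the disjuncts true on an encoded input with those merely possible: the former
are fewer but still contain the first of the latter. -/
theorem firstElem_subset {α : Type} {T U : Set α} {a : α} (h : firstElem T = some a)
    (hU : U ⊆ T) (ha : a ∈ U) : firstElem U = some a := by
  have hUne : U.Nonempty := ⟨a, ha⟩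
  have hTne : T.Nonempty := ⟨a, hU ha⟩
  unfold firstElem at h ⊢
  rw [dif_pos hTne] at h
  rw [dif_pos hUne]
  congr 1
  have wo := WellOrderingRel.isWellOrder (α := α)
  have h1 := WellFounded.not_lt_min wo.wf U ha
  have h2 := WellFounded.not_lt_min wo.wf T (hU (WellFounded.min_mem wo.wf U hUne))
  rw [Option.some.inj h] at h2
  exact ((trichotomous_of WellOrderingRel _ _).resolve_left h2 |>.resolve_right h1)

variable {V : Type} [Fintype V] [DecidableEq V]

/-- The values of `x` on `K`, and `false` elsewhere. -/
def mask (K : Finset V) (x : V → Bool) : V → Bool := K.piecewise x fun _ => false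

/-- An adaptive strategy for examining functions one after the other. At each step it names a
function `j` and the values `c` to be used on the coordinates examined before; it then learns the
coordinates examined so far, the true values on them, and which of them are live. -/
inductive Strategy (J V : Type) : Type
  | halt : Strategy J V
  | step (j : J) (c : V → Bool)
      (next : Finset V → (V → Bool) → Finset V → Strategy J V) : Strategy J V

/-- An adaptive strategy in which the function to examine next may depend on the whole input. -/
inductive SelStrategy (J V : Type) : Type
  | halt : SelStrategy J V
  | step (sel : (V → Bool) → Option J) (c : V → Bool)
      (next : Option J → Finset V → (V → Bool) → Finset V → SelStrategy J V) : SelStrategy J V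

variable {J I : Type}

/-- The coordinates examined when a strategy is run on `x` with `K` examined already. -/
def Strategy.final (ev : J → (V → Bool) → Finset V → Finset V) (S : Finset V) (x : V → Bool) :
    Strategy J V → Finset V → Finset V
  | .halt, K => K
  | .step j c next, K =>
      let K' := K ∪ ev j (K.piecewise c x) K
      (next K' (mask K' x) (S ∩ K')).final ev S x K'

/-- The number of steps of a strategy. -/
def Strategy.len (ev : J → (V → Bool) → Finset V → Finset V) (S : Finset V) (x : V → Bool) :
    Strategy J V → Finset V → ℕ
  | .halt, _ => 0
  | .step j c next, K =>
      let K' := K ∪ ev j (K.piecewise c x) K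
      (next K' (mask K' x) (S ∩ K')).len ev S x K' + 1

/-- The coordinates known after one further examination. -/
def knownAfter (ev : J → (V → Bool) → Finset V → Finset V) (K : Finset V) (x : V → Bool) :
    Option J → Finset V
  | none => K
  | some j => K ∪ ev j x K

/-- The coordinates examined when a strategy is run on `x` with `K` examined already. -/
def SelStrategy.final (ev : J → (V → Bool) → Finset V → Finset V) (S : Finset V) (x : V → Bool) :
    SelStrategy J V → Finset V → Finset V
  | .halt, K => K
  | .step sel c next, K =>
      let K' := knownAfter ev K (K.piecewise c x) (sel (K.piecewise c x))
      (next (sel (K.piecewise c x)) K' (mask K' x) (S ∩ K')).final ev S x K'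

/-- The number of steps of a strategy. -/
def SelStrategy.len (ev : J → (V → Bool) → Finset V → Finset V) (S : Finset V) (x : V → Bool) :
    SelStrategy J V → Finset V → ℕ
  | .halt, _ => 0
  | .step sel c next, K =>
      let K' := knownAfter ev K (K.piecewise c x) (sel (K.piecewise c x))
      (next (sel (K.piecewise c x)) K' (mask K' x) (S ∩ K')).len ev S x K' + 1

/-- `ev j x K` is a certificate for the value of `h j` at `x`, relative to the values on `K` and on
the coordinates that are not live, and these certificates are unambiguous. -/
def Certifies (h : J → (V → Bool) → Bool) (S : Finset V)
    (ev : J → (V → Bool) → Finset V → Finset V) : Prop :=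
  ∀ j x x' K, (∀ v, v ∈ K ∨ v ∉ S ∨ v ∈ ev j x K → x' v = x v) →
    ev j x' K = ev j x K ∧ h j x' = h j x

/-- The signed functions in `T` that some assignment compatible with the known values makes true. -/
def liveSet (h : J → (V → Bool) → Bool) (S : Finset V) (T : Set (J × Bool)) (x : V → Bool)
    (K : Finset V) : Set (J × Bool) :=
  {p | p ∈ T ∧ ∃ y : V → Bool, (∀ v, v ∈ K ∨ v ∉ S → y v = x v) ∧ h p.1 y = p.2}

/-- An assignment compatible with the known values that makes a signed function true. -/
noncomputable def witness (h : J → (V → Bool) → Bool) (S : Finset V) (p : J × Bool) (x : V → Bool)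
    (K : Finset V) : V → Bool :=
  Classical.epsilon fun y : V → Bool => (∀ v, v ∈ K ∨ v ∉ S → y v = x v) ∧ h p.1 y = p.2

theorem witness_spec {h : J → (V → Bool) → Bool} {S : Finset V} {T : Set (J × Bool)}
    {p : J × Bool} {x : V → Bool} {K : Finset V} (hp : p ∈ liveSet h S T x K) :
    (∀ v, v ∈ K ∨ v ∉ S → witness h S p x K v = x v) ∧ h p.1 (witness h S p x K) = p.2 :=
  Classical.epsilon_spec hp.2

/-! ### Canonical evaluation of a disjunction. -/

/-- Evaluation of a disjunction of signed functions, of which at most the coordinates in `S` are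
unknown: examine a witness for the first live disjunct, until the disjunction is decided. -/
noncomputable def orLoop (h : J → (V → Bool) → Bool) (ev : J → (V → Bool) → Finset V → Finset V)
    (S : Finset V) (T : Set (J × Bool)) (x : V → Bool) : ℕ → Finset V → Finset V
  | 0, K => K
  | n + 1, K =>
      match firstElem (liveSet h S T x K) with
      | none => K
      | some p =>
          let y := witness h S p x K
          let A := ev p.1 y K
          if ∀ v ∈ A, x v = y v then K ∪ A else orLoop h ev S T x n (K ∪ A)

section OrLoop

variable {h : J → (V → Bool) → Bool} {ev : J → (V → Bool) → Finset V → Finset V}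
  {S S' : Finset V} {T : Set (J × Bool)}

theorem subset_orLoop (x : V → Bool) (n : ℕ) (K : Finset V) : K ⊆ orLoop h ev S T x n K := by
  induction n generalizing K with
  | zero => exact subset_rfl
  | succ n ih =>
    rw [orLoop]
    split
    · exact subset_rfl
    · dsimp only
      split_ifs
      · exact Finset.subset_union_left
      · exact Finset.subset_union_left.trans (ih _)

theorem liveSet_congr {x x' : V → Bool} {K : Finset V} (hx : ∀ v, v ∈ K ∨ v ∉ S → x' v = x v) :
    liveSet h S T x' K = liveSet h S T x K := by
  have : ∀ y : V → Bool, (∀ v, v ∈ K ∨ v ∉ S → y v = x' v) ↔ (∀ v, v ∈ K ∨ v ∉ S → y v = x v) :=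
    fun y => forall₂_congr fun v hv => by rw [hx v hv]
  simp only [liveSet, this]

theorem witness_congr {p : J × Bool} {x x' : V → Bool} {K : Finset V}
    (hx : ∀ v, v ∈ K ∨ v ∉ S → x' v = x v) : witness h S p x' K = witness h S p x K := by
  have : ∀ y : V → Bool, (∀ v, v ∈ K ∨ v ∉ S → y v = x' v) ↔ (∀ v, v ∈ K ∨ v ∉ S → y v = x v) :=
    fun y => forall₂_congr fun v hv => by rw [hx v hv]
  simp only [witness, this]

/-- Live sets and witnesses depend only on values already known, and each comparison with a witness
reads only coordinates that are then added to the output. This is the unambiguity half of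
`Certifies`. -/
theorem orLoop_congr {x x' : V → Bool} (n : ℕ) (K : Finset V)
    (hx : ∀ v, v ∈ orLoop h ev S T x n K ∨ v ∉ S → x' v = x v) :
    orLoop h ev S T x' n K = orLoop h ev S T x n K := by
  induction n generalizing K with
  | zero => rfl
  | succ n ih =>
    have hK : ∀ v, v ∈ K ∨ v ∉ S → x' v = x v := fun v hv =>
      hx v (hv.imp_left fun h => subset_orLoop _ _ _ h)
    rw [orLoop] at hx
    rw [orLoop, orLoop, liveSet_congr hK]
    split at hx
    · rfl
    · next p e =>
      simp only [witness_congr hK]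
      dsimp only at hx
      split_ifs at hx with hc
      · have hc' : ∀ v ∈ ev p.1 (witness h S p x K) K, x' v = witness h S p x K v := fun v hv => by
          rw [hx v (Or.inl (Finset.mem_union_right _ hv)), hc v hv]
        rw [if_pos hc', if_pos hc]
      · have hA : ∀ v ∈ ev p.1 (witness h S p x K) K, x' v = x v := fun v hv =>
          hx v (Or.inl (subset_orLoop _ _ _ (Finset.mem_union_right _ hv)))
        have hc' : ¬ ∀ v ∈ ev p.1 (witness h S p x K) K, x' v = witness h S p x K v := fun H =>
          hc fun v hv => by rw [← hA v hv, H v hv]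
        rw [if_neg hc', if_neg hc]
        exact ih _ hx

/-- The loop stops when no disjunct is possible, or when the input agrees with a witness on its
certificate, which makes that disjunct true. Any other round exposes a disagreement at a new live
coordinate, so more rounds than unknown live coordinates suffice. -/
theorem orLoop_decides (hcert : Certifies h S ev) (hS : S' ⊆ S) {x x' : V → Bool} (n : ℕ)
    (K : Finset V) (hn : (S' \ K).card < n)
    (hx : ∀ v, v ∈ orLoop h ev S' T x n K ∨ v ∉ S' → x' v = x v) :
    (∃ p ∈ T, h p.1 x' = p.2) ↔ ∃ p ∈ T, h p.1 x = p.2 := by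
  induction n generalizing K with
  | zero => omega
  | succ n ih =>
    have hK : ∀ v, v ∈ K ∨ v ∉ S' → x' v = x v := fun v hv =>
      hx v (hv.imp_left fun h => subset_orLoop _ _ _ h)
    rw [orLoop] at hx
    split at hx
    · next e =>
      rw [firstElem_eq_none] at e
      have key : ∀ y : V → Bool, (∀ v, v ∈ K ∨ v ∉ S' → y v = x v) → ¬ ∃ p ∈ T, h p.1 y = p.2 := by
        rintro y hy ⟨p, hp, hpy⟩
        have : p ∈ liveSet h S' T x K := ⟨hp, y, hy, hpy⟩
        rw [e] at this
        exact this
      exact iff_of_false (key x' hK) (key x fun _ _ => rfl)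
    · next p e =>
      have hp := firstElem_mem e
      obtain ⟨hw1, hw2⟩ := witness_spec hp
      dsimp only at hx
      split_ifs at hx with hc
      · have key : ∀ z : V → Bool, (∀ v, v ∈ K ∪ ev p.1 (witness h S' p x K) K ∨ v ∉ S' → z v = x v) →
            ∃ p ∈ T, h p.1 z = p.2 := by
          intro z hz
          refine ⟨p, hp.1, ?_⟩
          rw [(hcert p.1 (witness h S' p x K) z K ?_).2, hw2]
          rintro v (hv | hv | hv)
          · rw [hw1 v (Or.inl hv), hz v (Or.inl (Finset.mem_union_left _ hv))]
          · have hv' : v ∉ S' := fun h => hv (hS h)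
            rw [hw1 v (Or.inr hv'), hz v (Or.inr hv')]
          · rw [← hc v hv, hz v (Or.inl (Finset.mem_union_right _ hv))]
        exact iff_of_true (key x' hx) (key x fun _ _ => rfl)
      · refine ih _ ?_ hx
        push Not at hc
        obtain ⟨v, hv, hne⟩ := hc
        have hvK : ¬ (v ∈ K ∨ v ∉ S') := fun H => hne (hw1 v H).symm
        push Not at hvK
        have : S' \ (K ∪ ev p.1 (witness h S' p x K) K) ⊂ S' \ K := by
          refine (Finset.ssubset_iff_of_subset
            (Finset.sdiff_subset_sdiff subset_rfl Finset.subset_union_left)).2 ⟨v, ?_, ?_⟩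
          · simp [hvK]
          · simp [hv]
        have := Finset.card_lt_card this
        omega

end OrLoop

/-- The evaluator of a family of disjunctions. -/
noncomputable def orEval (h : J → (V → Bool) → Bool) (ev : J → (V → Bool) → Finset V → Finset V)
    (S : Finset V) (T : I → Set (J × Bool)) (i : I) (x : V → Bool) (K : Finset V) : Finset V :=
  orLoop h ev S (T i) x (Fintype.card V + 1) K

open scoped Classical in
theorem certifies_orEval {h : J → (V → Bool) → Bool} {ev : J → (V → Bool) → Finset V → Finset V}
    {S S' : Finset V} (hcert : Certifies h S ev) (hS : S' ⊆ S) (T : I → Set (J × Bool)) :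
    Certifies (fun i x => decide (∃ p ∈ T i, h p.1 x = p.2)) S' (orEval h ev S' T) := by
  intro i x x' K hx
  have hx' : ∀ v, v ∈ orLoop h ev S' (T i) x (Fintype.card V + 1) K ∨ v ∉ S' → x' v = x v :=
    fun v hv => hx v (Or.inr hv.symm)
  refine ⟨orLoop_congr _ _ hx', ?_⟩
  rw [decide_eq_decide]
  exact orLoop_decides hcert hS _ _ (Nat.lt_succ_of_le (Finset.card_le_univ _)) hx'

/-! ### Encoded inputs and simulation by the layer below. -/

/-- The true values, recovered from the code `μ` and the encoded values `z`, on live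
coordinates `σ`. -/
def decodeMask (μ : V → Option Bool) (z : V → Bool) (σ : Finset V) : V → Bool :=
  fun v => if v ∈ σ then (μ v).getD (z v) else z v

/-- The coordinates of `σ` that remain live according to the code `μ`. -/
def decodeLive (μ : V → Option Bool) (σ : Finset V) : Finset V := σ.filter fun v => (μ v).isSome

/-- The simulation of `orLoop` on an encoded input. -/
noncomputable def simLoop (h : J → (V → Bool) → Bool) (T : Set (J × Bool)) (μ : V → Option Bool)
    (cont : Finset V → (V → Bool) → Finset V → SelStrategy J V) :
    ℕ → Finset V → (V → Bool) → (V → Bool) → Finset V → SelStrategy J V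
  | 0, K, _, u, σ => cont K u σ
  | n + 1, K, c, _, _ =>
      .step (fun y => (firstElem {p | p ∈ T ∧ h p.1 y = p.2}).map Prod.fst) c
        fun oj K' z σ =>
          let u := decodeMask μ z σ
          -- On the new coordinates `z` carries the witness and `u` the true input, so this is the
          -- stopping test of `orLoop`.
          if oj = none ∨ ∀ v ∈ K', v ∉ K → u v = z v then cont K' u (decodeLive μ σ)
          -- Later rounds must see true values, not the witness, on the coordinates just examined;
          -- this is why a strategy step may prescribe values there.
          else simLoop h T μ cont n K' (K.piecewise c u) u (decodeLive μ σ)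

/-- The simulation, on an encoded input, of a strategy for disjunctions. -/
noncomputable def Strategy.simulate (h : J → (V → Bool) → Bool) (T : I → Set (J × Bool))
    (μ : V → Option Bool) :
    Strategy I V → Finset V → (V → Bool) → Finset V → SelStrategy J V
  | .halt, _, _, _ => .halt
  | .step i c next, K, u, σ =>
      simLoop h (T i) μ (fun K u σ => (next K u σ).simulate h T μ K u σ)
        (Fintype.card V + 1) K c u σ

/-- On the coordinates in `F`, the pair `(x', μ)` encodes the restriction `R` of the live
coordinates `S` together with the input `x`. -/
structure Codes (S : Finset V) (R x : V → Bool) (F : Finset V) (x' : V → Bool)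
    (μ : V → Option Bool) : Prop where
  eq_of_dead : ∀ v, v ∉ S ∨ R v = false → x' v = x v
  code : ∀ v ∈ F, v ∈ S → μ v = if R v then some (x v) else none

section Simulate

variable {h : J → (V → Bool) → Bool} {ev : J → (V → Bool) → Finset V → Finset V}
  {S F K : Finset V} {R x x' : V → Bool} {μ : V → Option Bool}

theorem Codes.decodeMask (hc : Codes S R x F x' μ) (hK : K ⊆ F) :
    decodeMask μ (mask K x') (S ∩ K) = mask K x := by
  funext v
  by_cases hv : v ∈ K
  · by_cases hS : v ∈ S
    · cases hR : R v <;>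
        simp [_root_.decodeMask, mask, hv, hS, hc.code v (hK hv) hS, hR, hc.eq_of_dead v]
    · simp [_root_.decodeMask, mask, hv, hS, hc.eq_of_dead v]
  · simp [_root_.decodeMask, mask, hv]

theorem Codes.decodeLive (hc : Codes S R x F x' μ) (hK : K ⊆ F) :
    decodeLive μ (S ∩ K) = (S.filter fun v => R v = true) ∩ K := by
  ext v
  simp only [_root_.decodeLive, Finset.mem_filter, Finset.mem_inter]
  constructor
  · rintro ⟨⟨h1, h2⟩, h3⟩
    rw [hc.code v (hK h2) h1] at h3
    cases hR : R v <;> simp_all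
  · rintro ⟨⟨h1, h3⟩, h2⟩
    rw [hc.code v (hK h2) h1]
    simp [h1, h2, h3]

/-- One evaluation of a disjunction may cost several simulated steps. Every step except the last one
pays for itself by exposing a new surviving coordinate, which the term `(S' ∩ K).card` accounts for.
-/
theorem simLoop_spec (hcert : Certifies h S ev) {T : Set (J × Bool)}
    {cont : (V → Option Bool) → Finset V → (V → Bool) → Finset V → SelStrategy J V} {m : ℕ}
    {e₀ xh : V → Bool} (n : ℕ) (K : Finset V) (c : V → Bool) (hxh : K.piecewise c x = xh)
    {L S' : Finset V} (hS' : S' = S.filter fun v => R v = true)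
    (hL : orLoop h ev S' T xh n K = L) (hF : L ⊆ F)
    (hcont : ∀ μ x', Codes S R x F x' μ → (∀ v ∈ F, v ∉ L → v ∈ S' → x' v = e₀ v) →
      (cont μ L (mask L x) (S' ∩ L)).final ev S x' L = F ∧
      (cont μ L (mask L x) (S' ∩ L)).len ev S x' L + (S' ∩ L).card ≤ m) :
    ∃ e : V → Bool, ∀ μ x', Codes S R x F x' μ → (∀ v ∈ F, v ∉ K → v ∈ S' → x' v = e v) →
      (simLoop h T μ (cont μ) n K c (mask K x) (S' ∩ K)).final ev S x' K = F ∧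
      (simLoop h T μ (cont μ) n K c (mask K x) (S' ∩ K)).len ev S x' K + (S' ∩ K).card
        ≤ m + 1 := by
  have hmem : ∀ v, v ∉ S' ↔ (v ∉ S ∨ R v = false) := by
    intro v
    rw [hS', Finset.mem_filter, not_and_or, Bool.not_eq_true]
  induction n generalizing K c with
  | zero =>
    obtain rfl : K = L := hL
    refine ⟨e₀, fun μ x' hc he => ?_⟩
    obtain ⟨h1, h2⟩ := hcont μ x' hc he
    exact ⟨h1, h2.trans (Nat.le_succ m)⟩
  | succ n ih =>
    rw [orLoop] at hL
    have hKv : ∀ v ∈ K, xh v = c v := fun v hv => by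
      rw [← hxh, Finset.piecewise_eq_of_mem _ _ _ hv]
    have hKv' : ∀ v ∉ K, xh v = x v := fun v hv => by
      rw [← hxh, Finset.piecewise_eq_of_notMem _ _ _ hv]
    have hagree : ∀ μ x', Codes S R x F x' μ → ∀ v, v ∈ K ∨ v ∉ S' →
        K.piecewise c x' v = xh v := by
      intro μ x' hc v hv
      by_cases hvK : v ∈ K
      · rw [Finset.piecewise_eq_of_mem _ _ _ hvK, hKv v hvK]
      · rw [Finset.piecewise_eq_of_notMem _ _ _ hvK, hKv' v hvK]
        exact hc.eq_of_dead v ((hmem v).1 (hv.resolve_left hvK))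
    split at hL
    · next e =>
      subst hL
      refine ⟨e₀, fun μ x' hc he => ?_⟩
      have hsel : firstElem {p : J × Bool | p ∈ T ∧ h p.1 (K.piecewise c x') = p.2} = none := by
        rw [firstElem_eq_none] at e ⊢
        rw [Set.eq_empty_iff_forall_notMem] at e ⊢
        rintro p ⟨hp, hpy⟩
        exact e p ⟨hp, _, hagree μ x' hc, hpy⟩
      obtain ⟨h1, h2⟩ := hcont μ x' hc he
      simp only [simLoop, SelStrategy.final, SelStrategy.len, hsel, Option.map_none, knownAfter,
        true_or, if_true, hc.decodeMask hF, hc.decodeLive hF, ← hS']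
      exact ⟨h1, by omega⟩
    · next p e =>
      obtain ⟨hw1, hw2⟩ := witness_spec (firstElem_mem e)
      set y := witness h S' p xh K with hy
      set A := ev p.1 y K with hA
      simp only [← hA] at hL
      have hKA : K ∪ A ⊆ F := by
        refine Finset.Subset.trans ?_ hF
        rw [← hL]
        split_ifs
        · exact subset_rfl
        · exact subset_orLoop _ _ _
      -- Every signed function true on the encoded input is still possible, and unambiguity makes
      -- `p` itself true there with the witness's certificate; hence the decoder also picks `p`.
      have hstage : ∀ μ x', Codes S R x F x' μ → (∀ v ∈ K ∪ A, v ∉ K → x' v = y v) →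
          firstElem {p : J × Bool | p ∈ T ∧ h p.1 (K.piecewise c x') = p.2} = some p ∧
            ev p.1 (K.piecewise c x') K = A := by
        intro μ x' hc hx'
        have hceq := hcert p.1 y (K.piecewise c x') K (by
          intro v hv
          by_cases hvK : v ∈ K
          · rw [hagree μ x' hc v (Or.inl hvK), hw1 v (Or.inl hvK)]
          · rcases hv with hv | hv | hv
            · exact absurd hv hvK
            · have hv' : v ∉ S' := (hmem v).2 (Or.inl hv)
              rw [hagree μ x' hc v (Or.inr hv'), hw1 v (Or.inr hv')]
            · rw [Finset.piecewise_eq_of_notMem _ _ _ hvK]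
              exact hx' v (Finset.mem_union_right _ hv) hvK)
        refine ⟨firstElem_subset e ?_ ?_, hceq.1⟩
        · rintro p' ⟨hp', hpy⟩
          exact ⟨hp', _, hagree μ x' hc, hpy⟩
        · exact ⟨(firstElem_mem e).1, by rw [hceq.2, hw2]⟩
      have hfresh : ∀ μ x', Codes S R x F x' μ →
          (∀ v ∈ K ∪ A, v ∉ K → v ∈ S' → x' v = y v) → ∀ v ∈ K ∪ A, v ∉ K → x' v = y v := by
        intro μ x' hc hx' v hv hvK
        by_cases hvS : v ∈ S'
        · exact hx' v hv hvK hvS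
        · rw [hw1 v (Or.inr hvS), hKv' v hvK, hc.eq_of_dead v ((hmem v).1 hvS)]
      have hcond : ∀ x', (∀ v ∈ K ∪ A, v ∉ K → x' v = y v) →
          ((∀ v ∈ K ∪ A, v ∉ K → mask (K ∪ A) x v = mask (K ∪ A) x' v) ↔
            ∀ v ∈ A, xh v = y v) := by
        intro x' hx'
        constructor
        · intro H v hv
          by_cases hvK : v ∈ K
          · exact (hw1 v (Or.inl hvK)).symm
          · have hv' := Finset.mem_union_right K hv
            have := H v hv' hvK
            rw [mask, mask, Finset.piecewise_eq_of_mem _ _ _ hv',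
              Finset.piecewise_eq_of_mem _ _ _ hv', hx' v hv' hvK] at this
            rw [hKv' v hvK, this]
        · intro H v hv hvK
          have hvA : v ∈ A := (Finset.mem_union.1 hv).resolve_left hvK
          rw [mask, mask, Finset.piecewise_eq_of_mem _ _ _ hv,
            Finset.piecewise_eq_of_mem _ _ _ hv, hx' v hv hvK, ← H v hvA, hKv' v hvK]
      split_ifs at hL with hagr
      -- The encoded values are those of this round's witness on its certificate and those of the
      -- continuation elsewhere.
      · refine ⟨fun v => if v ∈ K ∪ A then y v else e₀ v, fun μ x' hc he => ?_⟩
        have hx' := hfresh μ x' hc fun v hv hvK hvS =>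
          (he v (hKA hv) hvK hvS).trans (if_pos hv)
        obtain ⟨hsel, hev⟩ := hstage μ x' hc hx'
        rw [← hL] at hcont
        obtain ⟨h1, h2⟩ := hcont μ x' hc fun v hv hvL hvS =>
          (he v hv (fun h => hvL (Finset.mem_union_left _ h)) hvS).trans (if_neg hvL)
        have hdec := (hcond x' hx').2 hagr
        simp only [simLoop, SelStrategy.final, SelStrategy.len, hsel, Option.map_some, knownAfter,
          hev, hc.decodeMask hKA, hc.decodeLive hKA, ← hS', if_pos (Or.inr hdec)]
        refine ⟨h1, ?_⟩
        have := Finset.card_le_card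
          (Finset.inter_subset_inter_left (s := S') (Finset.subset_union_left (s₁ := K) (s₂ := A)))
        omega
      · obtain ⟨e₁, he₁⟩ := ih (K ∪ A) (K.piecewise c (mask (K ∪ A) x)) (by
          rw [← hxh]
          funext v
          by_cases hvK : v ∈ K
          · simp [hvK]
          · by_cases hvA : v ∈ A <;> simp [hvK, hvA, mask]) hL
        refine ⟨fun v => if v ∈ K ∪ A then y v else e₁ v, fun μ x' hc he => ?_⟩
        have hx' := hfresh μ x' hc fun v hv hvK hvS =>
          (he v (hKA hv) hvK hvS).trans (if_pos hv)
        obtain ⟨hsel, hev⟩ := hstage μ x' hc hx'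
        obtain ⟨h1, h2⟩ := he₁ μ x' hc fun v hv hvL hvS =>
          (he v hv (fun h => hvL (Finset.mem_union_left _ h)) hvS).trans (if_neg hvL)
        have hdec := mt (hcond x' hx').1 hagr
        have hdec' : ¬ (some p.1 = none ∨ ∀ v ∈ K ∪ A, v ∉ K →
            mask (K ∪ A) x v = mask (K ∪ A) x' v) := by
          rintro (h | h)
          · exact Option.some_ne_none _ h
          · exact hdec h
        simp only [simLoop, SelStrategy.final, SelStrategy.len, hsel, Option.map_some, knownAfter,
          hev, hc.decodeMask hKA, hc.decodeLive hKA, ← hS', if_neg hdec']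
        refine ⟨h1, ?_⟩
        -- The disagreement with the witness occurs at a fresh surviving coordinate, so `S' ∩ K`
        -- grows strictly and pays for the extra step.
        push Not at hagr
        obtain ⟨v, hvA, hne⟩ := hagr
        have hv : ¬ (v ∈ K ∨ v ∉ S') := fun H => hne (hw1 v H).symm
        push Not at hv
        have : S' ∩ K ⊂ S' ∩ (K ∪ A) := by
          refine (Finset.ssubset_iff_of_subset
            (Finset.inter_subset_inter_left Finset.subset_union_left)).2 ⟨v, ?_, ?_⟩
          · simp [hv.2, hvA]
          · simp [hv.1]
        have := Finset.card_lt_card this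
        omega

theorem Strategy.subset_final (st : Strategy J V) (K : Finset V) : K ⊆ st.final ev S x K := by
  induction st generalizing K with
  | halt => exact subset_rfl
  | step j c next ih => exact Finset.subset_union_left.trans (ih _ _ _ _)

/-- The vector `e` is chosen before the code: it depends only on the true run, so the encoded input
is well defined and one simulation serves every compatible code. -/
theorem Strategy.simulate_spec (hcert : Certifies h S ev) (T : I → Set (J × Bool)) {S' : Finset V}
    (hS' : S' = S.filter fun v => R v = true) (st : Strategy I V) (K : Finset V)
    (hF : st.final (orEval h ev S' T) S' x K = F) :
    ∃ e : V → Bool, ∀ μ x', Codes S R x F x' μ → (∀ v ∈ F, v ∉ K → v ∈ S' → x' v = e v) →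
      (st.simulate h T μ K (mask K x) (S' ∩ K)).final ev S x' K = F ∧
      (st.simulate h T μ K (mask K x) (S' ∩ K)).len ev S x' K + (S' ∩ K).card
        ≤ st.len (orEval h ev S' T) S' x K + (S' ∩ F).card := by
  induction st generalizing K with
  | halt =>
    obtain rfl : K = F := hF
    exact ⟨x, fun μ x' _ _ => ⟨rfl, by simp [Strategy.simulate, SelStrategy.len, Strategy.len]⟩⟩
  | step i c next ih =>
    rw [Strategy.final] at hF
    set L := orEval h ev S' T i (K.piecewise c x) K with hL
    have hKL : K ∪ L = L := Finset.union_eq_right.2 (subset_orLoop _ _ _)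
    simp only [hKL] at hF
    obtain ⟨e₀, he₀⟩ := ih L (mask L x) (S' ∩ L) L hF
    obtain ⟨e, he⟩ := simLoop_spec (R := R) (F := F) hcert (T := T i)
      (cont := fun μ K u σ => (next K u σ).simulate h T μ K u σ) (Fintype.card V + 1) K c rfl hS'
      hL.symm (hF ▸ Strategy.subset_final _ _) he₀
    refine ⟨e, fun μ x' hc hx' => ?_⟩
    obtain ⟨h1, h2⟩ := he μ x' hc hx'
    refine ⟨h1, ?_⟩
    have : (Strategy.step i c next).len (orEval h ev S' T) S' x K
        = (next L (mask L x) (S' ∩ L)).len (orEval h ev S' T) S' x L + 1 := by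
      simp only [Strategy.len, ← hL, hKL]
    rw [this]
    exact h2.trans (by omega)

end Simulate

/-! ### The weighted counting argument. -/

/-- The probability of the set `R` when each coordinate is kept independently with
probability `q`. -/
def starWeight (q : ℝ) (R : V → Bool) : ℝ := ∏ v, if R v then q else 1 - q

/-- The probability of a code when each letter has probability `w` and `none` has the rest. -/
def codeWeight (w : ℝ) (μ : V → Option Bool) : ℝ := ∏ v, if (μ v).isSome then w else 1 - 2 * w

theorem sum_starWeight (q : ℝ) : ∑ R : V → Bool, starWeight q R = 1 := by
  unfold starWeight
  rw [← Fintype.piFinset_univ, ← Finset.prod_univ_sum (fun _ => Finset.univ)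
    (fun (_ : V) (b : Bool) => if b then q else 1 - q)]
  simp

theorem sum_codeWeight (w : ℝ) : ∑ μ : V → Option Bool, codeWeight w μ = 1 := by
  unfold codeWeight
  rw [← Fintype.piFinset_univ, ← Finset.prod_univ_sum (fun _ => Finset.univ)
    (fun (_ : V) (b : Option Bool) => if b.isSome then w else 1 - 2 * w)]
  refine Finset.prod_eq_one fun v _ => ?_
  rw [Fintype.sum_option]
  simp

theorem starWeight_nonneg {q : ℝ} (h0 : 0 ≤ q) (h1 : q ≤ 1) (R : V → Bool) :
    0 ≤ starWeight q R :=
  Finset.prod_nonneg fun v _ => by split_ifs <;> linarith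

theorem codeWeight_nonneg {w : ℝ} (h0 : 0 ≤ w) (h1 : w ≤ 1 / 2) (μ : V → Option Bool) :
    0 ≤ codeWeight w μ :=
  Finset.prod_nonneg fun v _ => by split_ifs <;> linarith

section Encode

theorem sum_cylinder_ge {w q a : ℝ} (hq : 0 ≤ q) (hq1 : q ≤ 1) (hwq : 8 * q ≤ w) (ha : 1 ≤ a)
    (hwa : 1 ≤ (1 - 2 * w) * a) (D : Finset V) (R x : V → Bool) :
    starWeight q R * 8 ^ (D.filter fun v => R v = true).card ≤
      (∑ R' ∈ Fintype.piFinset fun v => if v ∈ D then Finset.univ else {R v}, starWeight q R') *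
      (∑ μ ∈ Fintype.piFinset fun v =>
        if v ∈ D then {if R v then some (x v) else none} else Finset.univ, codeWeight w μ)
        * a ^ D.card := by
  have h1 : (∑ R' ∈ Fintype.piFinset fun v => if v ∈ D then Finset.univ else {R v},
      starWeight q R') = ∏ v, if v ∈ D then 1 else if R v then q else 1 - q := by
    unfold starWeight
    rw [← Finset.prod_univ_sum _ (fun (_ : V) (b : Bool) => if b then q else 1 - q)]
    refine Finset.prod_congr rfl fun v _ => ?_
    split_ifs <;> simp_all
  have h2 : (∑ μ ∈ Fintype.piFinset fun v =>
        if v ∈ D then {if R v then some (x v) else none} else Finset.univ, codeWeight w μ)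
      = ∏ v, if v ∈ D then (if R v then w else 1 - 2 * w) else 1 := by
    unfold codeWeight
    rw [← Finset.prod_univ_sum _
      (fun (_ : V) (b : Option Bool) => if b.isSome then w else 1 - 2 * w)]
    refine Finset.prod_congr rfl fun v _ => ?_
    split_ifs with h1 h2
    · simp
    · simp
    · rw [Fintype.sum_option]
      simp
  have h3 : a ^ D.card = ∏ v, if v ∈ D then a else 1 := by
    rw [Finset.prod_ite_mem, Finset.univ_inter, Finset.prod_const]
  have h4 : (8 : ℝ) ^ (D.filter fun v => R v = true).card
      = ∏ v, if v ∈ D ∧ R v = true then 8 else 1 := by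
    rw [← Finset.prod_const, Finset.prod_filter, ← Finset.univ_inter D, ← Finset.prod_ite_mem]
    refine Finset.prod_congr rfl fun v _ => ?_
    by_cases hv : v ∈ D <;> simp [hv]
  rw [h1, h2, h3, h4, starWeight, ← Finset.prod_mul_distrib, ← Finset.prod_mul_distrib,
    ← Finset.prod_mul_distrib]
  refine Finset.prod_le_prod (fun v _ => ?_) fun v _ => ?_
  · split_ifs <;> simp <;> linarith
  -- The inequality holds factor by factor: on `D` it says `1 - q ≤ (1 - 2 * w) * a` for a dropped
  -- coordinate and `8 * q ≤ w * a` for a kept one.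
  · by_cases hv : v ∈ D <;> cases hR : R v <;> simp [hv]
    · linarith
    · nlinarith

/-- The codes that describe the restriction `p.1` and the input `p.2` on the coordinates in `D`. -/
def codeCylinder (p : (V → Bool) × (V → Bool)) (D : Finset V) : Finset (V → Option Bool) :=
  Fintype.piFinset fun v =>
    if v ∈ D then {if p.1 v then some (p.2 v) else none} else Finset.univ

/-- The restrictions that agree with `p.1` outside `D`. -/
def starCylinder (p : (V → Bool) × (V → Bool)) (D : Finset V) : Finset (V → Bool) :=
  Fintype.piFinset fun v => if v ∈ D then Finset.univ else {p.1 v}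

theorem mem_codeCylinder {p : (V → Bool) × (V → Bool)} {D : Finset V} {μ : V → Option Bool} :
    μ ∈ codeCylinder p D ↔ ∀ v ∈ D, μ v = if p.1 v then some (p.2 v) else none := by
  rw [codeCylinder, Fintype.mem_piFinset]
  refine forall_congr' fun v => ?_
  by_cases hv : v ∈ D <;> simp [hv]

theorem mem_starCylinder {p : (V → Bool) × (V → Bool)} {D : Finset V} {R : V → Bool} :
    R ∈ starCylinder p D ↔ ∀ v ∉ D, R v = p.1 v := by
  rw [starCylinder, Fintype.mem_piFinset]
  refine forall_congr' fun v => ?_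
  by_cases hv : v ∈ D <;> simp [hv]

/-- A weighted counting bound: the pairs of a restriction and an input are encoded, with the
help of a code on the coordinates `D p`, by modified inputs. -/
theorem sum_le_of_encoding {w q a : ℝ} (hq : 0 ≤ q) (hq1 : q ≤ 1) (hwq : 8 * q ≤ w)
    (hw : w ≤ 1 / 2) (ha : 1 ≤ a) (hwa : 1 ≤ (1 - 2 * w) * a)
    (D : (V → Bool) × (V → Bool) → Finset V) (enc : (V → Bool) × (V → Bool) → V → Bool)
    (k : (V → Bool) × (V → Bool) → ℕ) (H : (V → Option Bool) → (V → Bool) → ℝ)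
    (hH : ∀ μ x, 0 ≤ H μ x) (henc : ∀ p v, v ∉ D p ∨ p.1 v = false → enc p v = p.2 v)
    (hinj : ∀ p₁ p₂ μ, μ ∈ codeCylinder p₁ (D p₁) → μ ∈ codeCylinder p₂ (D p₂) →
      enc p₁ = enc p₂ → D p₁ = D p₂)
    (hlow : ∀ p, ∀ μ ∈ codeCylinder p (D p),
      (1 / 4 : ℝ) ^ (k p + ((D p).filter fun v => p.1 v = true).card) * a ^ (D p).card
        ≤ H μ (enc p)) :
    ∑ p : (V → Bool) × (V → Bool), starWeight q p.1 *
      ((1 / 4 : ℝ) ^ k p * 2 ^ ((D p).filter fun v => p.1 v = true).card)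
    ≤ ∑ μ : V → Option Bool, codeWeight w μ * ∑ x : V → Bool, H μ x := by
  have hw0 : 0 ≤ w := by linarith
  let cyl : (V → Bool) × (V → Bool) → Finset ((V → Bool) × (V → Bool) × (V → Option Bool)) :=
    fun p => {enc p} ×ˢ starCylinder p (D p) ×ˢ codeCylinder p (D p)
  let W : (V → Bool) × (V → Bool) × (V → Option Bool) → ℝ := fun b =>
    starWeight q b.2.1 * (codeWeight w b.2.2 * H b.2.2 b.1)
  have hW : ∀ b, 0 ≤ W b := fun b => mul_nonneg (starWeight_nonneg hq hq1 _)
    (mul_nonneg (codeWeight_nonneg hw0 hw _) (hH _ _))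
  have hdisj : ((Finset.univ : Finset ((V → Bool) × (V → Bool))) : Set _).PairwiseDisjoint cyl := by
    intro p₁ _ p₂ _ hne
    rw [Function.onFun, Finset.disjoint_left]
    rintro ⟨x', R', μ⟩ hb₁ hb₂
    simp only [cyl, Finset.mem_product, Finset.mem_singleton] at hb₁ hb₂
    obtain ⟨hx₁, hR₁, hμ₁⟩ := hb₁
    obtain ⟨hx₂, hR₂, hμ₂⟩ := hb₂
    have hxx := hx₁.symm.trans hx₂
    have hDD := hinj p₁ p₂ μ hμ₁ hμ₂ hxx
    -- Decoding: the code gives the restriction on `D` and the input at its kept coordinates, `R'`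
    -- gives the restriction off `D`, and the encoded input is unaltered everywhere else.
    have key : ∀ v, p₁.1 v = p₂.1 v ∧ p₁.2 v = p₂.2 v := by
      intro v
      have hxv := congrFun hxx v
      have e₁ := henc p₁ v
      have e₂ := henc p₂ v
      rw [← hDD] at e₂
      by_cases hv : v ∈ D p₁
      · have hc₁ := mem_codeCylinder.1 hμ₁ v hv
        have hc₂ := mem_codeCylinder.1 hμ₂ v (hDD ▸ hv)
        rw [hc₁] at hc₂
        cases h1 : p₁.1 v <;> cases h2 : p₂.1 v <;> simp_all
      · have hr₁ := mem_starCylinder.1 hR₁ v hv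
        have hr₂ := mem_starCylinder.1 hR₂ v (hDD ▸ hv)
        exact ⟨hr₁.symm.trans hr₂, by rw [← e₁ (Or.inl hv), ← e₂ (Or.inl hv), hxv]⟩
    exact hne (Prod.ext (funext fun v => (key v).1) (funext fun v => (key v).2))
  have hstep : ∀ p, starWeight q p.1 *
      ((1 / 4 : ℝ) ^ k p * 2 ^ ((D p).filter fun v => p.1 v = true).card) ≤ ∑ b ∈ cyl p, W b := by
    intro p
    set t := ((D p).filter fun v => p.1 v = true).card with ht
    have hcyl := sum_cylinder_ge hq hq1 hwq ha hwa (D p) p.1 p.2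
    rw [← ht] at hcyl
    -- The gain 8 per kept coordinate splits as 4 · 2: the 4 pays for the extra simulated step, the
    -- 2 is the moment wanted.
    calc _ = (1 / 4 : ℝ) ^ (k p + t) * (starWeight q p.1 * 8 ^ t) := by
          rw [pow_add, show (8 : ℝ) = 4 * 2 by norm_num, mul_pow, one_div, inv_pow, inv_pow]
          field_simp
      _ ≤ (1 / 4 : ℝ) ^ (k p + t) * ((∑ R' ∈ starCylinder p (D p), starWeight q R') *
          (∑ μ ∈ codeCylinder p (D p), codeWeight w μ) * a ^ (D p).card) :=
          mul_le_mul_of_nonneg_left hcyl (by positivity)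
      _ = ∑ R' ∈ starCylinder p (D p), starWeight q R' * ∑ μ ∈ codeCylinder p (D p),
          codeWeight w μ * ((1 / 4 : ℝ) ^ (k p + t) * a ^ (D p).card) := by
          rw [← Finset.sum_mul, ← Finset.sum_mul]
          ring
      _ ≤ ∑ R' ∈ starCylinder p (D p), starWeight q R' * ∑ μ ∈ codeCylinder p (D p),
          codeWeight w μ * H μ (enc p) :=
          Finset.sum_le_sum fun R' _ => mul_le_mul_of_nonneg_left
            (Finset.sum_le_sum fun μ hμ => mul_le_mul_of_nonneg_left (hlow p μ hμ)
              (codeWeight_nonneg hw0 hw μ)) (starWeight_nonneg hq hq1 R')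
      _ = _ := by
          simp only [cyl, W, Finset.sum_product, Finset.sum_singleton, Finset.mul_sum]
  refine (Finset.sum_le_sum fun p _ => hstep p).trans ?_
  rw [← Finset.sum_biUnion hdisj]
  refine (Finset.sum_le_univ_sum_of_nonneg hW).trans (le_of_eq ?_)
  simp only [W, Fintype.sum_prod_type, ← Finset.mul_sum, ← Finset.sum_mul, sum_starWeight, one_mul]
  rw [Finset.sum_comm]
  simp only [Finset.mul_sum]

/-- The encoding overwrites the examined kept coordinates by `e`. The simulation reconstructs the
examined set from the code and the encoded input alone, which gives the injectivity needed in
`sum_le_of_encoding`. -/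
theorem sum_le_of_simulation {w q a : ℝ} (hq : 0 ≤ q) (hq1 : q ≤ 1) (hwq : 8 * q ≤ w)
    (hw : w ≤ 1 / 2) (ha : 1 ≤ a) (hwa : 1 ≤ (1 - 2 * w) * a) (S : Finset V)
    (F : (V → Bool) × (V → Bool) → Finset V) (k : (V → Bool) × (V → Bool) → ℕ)
    (fin : (V → Option Bool) → (V → Bool) → Finset V) (len : (V → Option Bool) → (V → Bool) → ℕ)
    (he : ∀ p, ∃ e : V → Bool, ∀ μ x', Codes S p.1 p.2 (F p) x' μ →
      (∀ v ∈ F p, v ∈ S.filter (fun v => p.1 v = true) → x' v = e v) →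
      fin μ x' = F p ∧ len μ x' ≤ k p + (S.filter (fun v => p.1 v = true) ∩ F p).card) :
    ∑ p : (V → Bool) × (V → Bool), starWeight q p.1 *
      ((1 / 4 : ℝ) ^ k p * 2 ^ (S.filter (fun v => p.1 v = true) ∩ F p).card)
    ≤ ∑ μ : V → Option Bool, codeWeight w μ * ∑ x : V → Bool,
      ((1 / 4 : ℝ) ^ len μ x * a ^ (S ∩ fin μ x).card) := by
  choose e he using he
  have hsim : ∀ p, ∀ μ ∈ codeCylinder p (S ∩ F p),
      fin μ (fun v => if v ∈ S ∩ F p ∧ p.1 v = true then e p v else p.2 v) = F p ∧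
      len μ (fun v => if v ∈ S ∩ F p ∧ p.1 v = true then e p v else p.2 v)
        ≤ k p + (S.filter (fun v => p.1 v = true) ∩ F p).card := by
    intro p μ hμ
    refine he p μ _ ⟨fun v hv => ?_, fun v hvF hvS => ?_⟩ fun v hvF hvS => ?_
    · refine if_neg fun h => ?_
      rcases hv with hv | hv
      · exact hv (Finset.mem_inter.1 h.1).1
      · rw [h.2] at hv
        exact Bool.noConfusion hv
    · exact mem_codeCylinder.1 hμ v (Finset.mem_inter.2 ⟨hvS, hvF⟩)
    · rw [Finset.mem_filter] at hvS
      exact if_pos ⟨Finset.mem_inter.2 ⟨hvS.1, hvF⟩, hvS.2⟩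
  have hcard : ∀ p, (S.filter (fun v => p.1 v = true) ∩ F p).card
      = ((S ∩ F p).filter fun v => p.1 v = true).card := fun p => by rw [Finset.filter_inter]
  simp only [hcard] at hsim ⊢
  refine sum_le_of_encoding hq hq1 hwq hw ha hwa (fun p => S ∩ F p)
    (fun p v => if v ∈ S ∩ F p ∧ p.1 v = true then e p v else p.2 v) k
    (fun μ x => (1 / 4 : ℝ) ^ len μ x * a ^ (S ∩ fin μ x).card)
    (fun μ x => by positivity) (fun p v hv => if_neg ?_) (fun p₁ p₂ μ h₁ h₂ h => ?_)
    fun p μ hμ => ?_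
  · rintro ⟨h1, h2⟩
    rcases hv with hv | hv
    · exact hv h1
    · rw [h2] at hv
      exact Bool.noConfusion hv
  · rw [← (hsim p₁ μ h₁).1, ← (hsim p₂ μ h₂).1, h]
  · obtain ⟨h1, h2⟩ := hsim p μ hμ
    rw [h1]
    exact mul_le_mul_of_nonneg_right
      (pow_le_pow_of_le_one (by norm_num) (by norm_num) h2) (by positivity)

theorem sum_encode_le {h : J → (V → Bool) → Bool} {ev : J → (V → Bool) → Finset V → Finset V}
    {S : Finset V} (hcert : Certifies h S ev) (T : I → Set (J × Bool)) (st : Strategy I V)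
    {w q a : ℝ} (hq : 0 ≤ q) (hq1 : q ≤ 1) (hwq : 8 * q ≤ w) (hw : w ≤ 1 / 2) (ha : 1 ≤ a)
    (hwa : 1 ≤ (1 - 2 * w) * a) :
    ∑ R : V → Bool, starWeight q R * ∑ x : V → Bool,
      ((1 / 4 : ℝ) ^ st.len (orEval h ev (S.filter fun v => R v = true) T)
          (S.filter fun v => R v = true) x ∅ *
        2 ^ ((S.filter fun v => R v = true) ∩
          st.final (orEval h ev (S.filter fun v => R v = true) T)
            (S.filter fun v => R v = true) x ∅).card)
    ≤ ∑ μ : V → Option Bool, codeWeight w μ * ∑ x : V → Bool,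
      ((1 / 4 : ℝ) ^ (st.simulate h T μ ∅ (fun _ => false) ∅).len ev S x ∅ *
        a ^ (S ∩ (st.simulate h T μ ∅ (fun _ => false) ∅).final ev S x ∅).card) := by
  have hsum := sum_le_of_simulation hq hq1 hwq hw ha hwa S
    (fun p => st.final (orEval h ev (S.filter fun v => p.1 v = true) T)
      (S.filter fun v => p.1 v = true) p.2 ∅)
    (fun p => st.len (orEval h ev (S.filter fun v => p.1 v = true) T)
      (S.filter fun v => p.1 v = true) p.2 ∅)
    (fun μ x => (st.simulate h T μ ∅ (fun _ => false) ∅).final ev S x ∅)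
    (fun μ x => (st.simulate h T μ ∅ (fun _ => false) ∅).len ev S x ∅) (by
      intro p
      obtain ⟨e, he⟩ := st.simulate_spec (R := p.1) (x := p.2) (S := S) hcert T rfl ∅ rfl
      refine ⟨e, fun μ x' hc hx' => ?_⟩
      have := he μ x' hc fun v hv _ hvS => hx' v hv hvS
      have hmask : mask ∅ p.2 = fun _ => false := by simp [mask]
      rw [hmask, Finset.inter_empty, Finset.card_empty, add_zero] at this
      exact this)
  rw [Fintype.sum_prod_type] at hsum
  simp only [Finset.mul_sum] at hsum ⊢
  exact hsum

end Encode

/-! ### Random evaluators and the switching step. -/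

/-- A finitely supported random choice of live coordinates, with unambiguous certificates for the
functions `h j`. -/
structure RandomEvaluator (h : J → (V → Bool) → Bool) where
  Ω : Type
  [fintype : Fintype Ω]
  P : Ω → ℝ
  P_nonneg : ∀ ω, 0 ≤ P ω
  P_sum : ∑ ω, P ω = 1
  S : Ω → Finset V
  ev : Ω → J → (V → Bool) → Finset V → Finset V
  cert : ∀ ω, Certifies h (S ω) (ev ω)

attribute [instance] RandomEvaluator.fintype

namespace RandomEvaluator

variable {h : J → (V → Bool) → Bool}

/-- The number of live coordinates that an adaptive strategy examines has a bounded exponential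
moment, discounted by the number of steps. -/
def StrategyBound (E : RandomEvaluator h) : Prop :=
  ∀ st : Strategy J V, ∑ ω, E.P ω * ∑ x : V → Bool,
    ((1 / 4 : ℝ) ^ st.len (E.ev ω) (E.S ω) x ∅ *
      2 ^ (E.S ω ∩ st.final (E.ev ω) (E.S ω) x ∅).card) ≤ 2 ^ Fintype.card V

/-- The analogue of `StrategyBound` with base `a` for strategies that see the whole input. -/
def SelBound (E : RandomEvaluator h) (a : ℝ) : Prop :=
  ∀ st : SelStrategy J V, ∑ ω, E.P ω * ∑ x : V → Bool,
    ((1 / 4 : ℝ) ^ st.len (E.ev ω) (E.S ω) x ∅ *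
      a ^ (E.S ω ∩ st.final (E.ev ω) (E.S ω) x ∅).card) ≤ 2 ^ Fintype.card V

open scoped Classical in
/-- The random evaluator of a family of disjunctions of signed functions, when each live
coordinate is kept alive with probability `q`. -/
noncomputable def disj (E : RandomEvaluator h) (T : I → Set (J × Bool)) {q : ℝ} (hq : 0 ≤ q)
    (hq1 : q ≤ 1) : RandomEvaluator fun i x => decide (∃ p ∈ T i, h p.1 x = p.2) where
  Ω := E.Ω × (V → Bool)
  P p := E.P p.1 * starWeight q p.2
  P_nonneg p := mul_nonneg (E.P_nonneg _) (starWeight_nonneg hq hq1 _)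
  P_sum := by
    simp only [Fintype.sum_prod_type, ← Finset.mul_sum, sum_starWeight, mul_one, E.P_sum]
  S p := (E.S p.1).filter fun v => p.2 v = true
  ev p := orEval h (E.ev p.1) ((E.S p.1).filter fun v => p.2 v = true) T
  cert p := certifies_orEval (E.cert p.1) (Finset.filter_subset _ _) T

/-- For each fixed code the simulation is one strategy for the layer below, so `SelBound` applies to
it; averaging over codes costs nothing because their weights sum to one. -/
theorem strategyBound_disj (E : RandomEvaluator h) (T : I → Set (J × Bool)) {w q a : ℝ}
    (hq : 0 ≤ q) (hq1 : q ≤ 1) (hwq : 8 * q ≤ w) (hw : w ≤ 1 / 2) (ha : 1 ≤ a)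
    (hwa : 1 ≤ (1 - 2 * w) * a) (hE : E.SelBound a) : (E.disj T hq hq1).StrategyBound := by
  intro st
  have hw0 : 0 ≤ w := by linarith
  change ∑ p : E.Ω × (V → Bool), E.P p.1 * starWeight q p.2 * ∑ x : V → Bool,
    ((1 / 4 : ℝ) ^ st.len (orEval h (E.ev p.1) ((E.S p.1).filter fun v => p.2 v = true) T)
        ((E.S p.1).filter fun v => p.2 v = true) x ∅ *
      2 ^ ((E.S p.1).filter (fun v => p.2 v = true) ∩
        st.final (orEval h (E.ev p.1) ((E.S p.1).filter fun v => p.2 v = true) T)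
          ((E.S p.1).filter fun v => p.2 v = true) x ∅).card) ≤ 2 ^ Fintype.card V
  rw [Fintype.sum_prod_type]
  simp only [mul_assoc, ← Finset.mul_sum]
  calc _ ≤ ∑ ω, E.P ω * ∑ μ : V → Option Bool, codeWeight w μ * ∑ x : V → Bool,
        ((1 / 4 : ℝ) ^ (st.simulate h T μ ∅ (fun _ => false) ∅).len (E.ev ω) (E.S ω) x ∅ *
          a ^ (E.S ω ∩
            (st.simulate h T μ ∅ (fun _ => false) ∅).final (E.ev ω) (E.S ω) x ∅).card) :=
        Finset.sum_le_sum fun ω _ => mul_le_mul_of_nonneg_left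
          (sum_encode_le (E.cert ω) T st hq hq1 hwq hw ha hwa) (E.P_nonneg ω)
    _ = ∑ μ : V → Option Bool, codeWeight w μ * ∑ ω, E.P ω * ∑ x : V → Bool,
        ((1 / 4 : ℝ) ^ (st.simulate h T μ ∅ (fun _ => false) ∅).len (E.ev ω) (E.S ω) x ∅ *
          a ^ (E.S ω ∩
            (st.simulate h T μ ∅ (fun _ => false) ∅).final (E.ev ω) (E.S ω) x ∅).card) := by
        simp only [Finset.mul_sum (s := (Finset.univ : Finset (V → Option Bool))),
          Finset.mul_sum (s := (Finset.univ : Finset E.Ω))]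
        rw [Finset.sum_comm]
        refine Finset.sum_congr rfl fun μ _ => Finset.sum_congr rfl fun ω _ => ?_
        ring
    _ ≤ ∑ μ : V → Option Bool, codeWeight w μ * 2 ^ Fintype.card V :=
        Finset.sum_le_sum fun μ _ => mul_le_mul_of_nonneg_left (hE _) (codeWeight_nonneg hw0 hw μ)
    _ = 2 ^ Fintype.card V := by rw [← Finset.sum_mul, sum_codeWeight, one_mul]

end RandomEvaluator

/-! ### Removing knowledge of the whole input by guessing. -/

/-- The strategy that follows a given list of choices. -/
def SelStrategy.withChoices : SelStrategy J V → Finset V → (V → Bool) → Finset V →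
    List (Option J) → Strategy J V
  | .halt, _, _, _, _ => .halt
  | .step _ _ _, _, _, _, [] => .halt
  | .step _ _ next, K, z, σ, none :: l => (next none K z σ).withChoices K z σ l
  | .step _ c next, _, _, _, some j :: l =>
      .step j c fun K z σ => (next (some j) K z σ).withChoices K z σ l

section Choices

variable {ev : J → (V → Bool) → Finset V → Finset V} {S : Finset V} [Fintype J]

/-- Among all lists of choices, those starting with the choices actually made on `x` reproduce the
run. They form a fraction `card⁻¹ ^ len`, and the other terms are nonnegative. Skipped steps only
lower the discount. -/
theorem SelStrategy.le_sum_withChoices (x : V → Bool) (st : SelStrategy J V) (K : Finset V) (n : ℕ)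
    (hn : st.len ev S x K ≤ n) :
    ((Fintype.card (Option J) : ℝ)⁻¹) ^ st.len ev S x K *
        ((1 / 4 : ℝ) ^ st.len ev S x K * 2 ^ (S ∩ st.final ev S x K).card) ≤
      ((Fintype.card (Option J) : ℝ)⁻¹) ^ n * ∑ l : Fin n → Option J,
        ((1 / 4 : ℝ) ^ (st.withChoices K (mask K x) (S ∩ K) (List.ofFn l)).len ev S x K *
          2 ^ (S ∩ (st.withChoices K (mask K x) (S ∩ K) (List.ofFn l)).final ev S x K).card) := by
  have hM : (0 : ℝ) < Fintype.card (Option J) := by exact_mod_cast Fintype.card_pos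
  induction st generalizing K n with
  | halt =>
    simp only [SelStrategy.withChoices, SelStrategy.len, SelStrategy.final, Strategy.len,
      Strategy.final, pow_zero, one_mul, Finset.sum_const, Finset.card_univ, Fintype.card_fun,
      Fintype.card_fin, nsmul_eq_mul, Nat.cast_pow]
    rw [← mul_assoc, ← mul_pow, inv_mul_cancel₀ hM.ne', one_pow, one_mul]
  | step sel c next ih =>
    cases n with
    | zero => simp [SelStrategy.len] at hn
    | succ n =>
      rw [SelStrategy.len] at hn
      rw [← (Fin.consEquiv fun _ => Option J).sum_comp, Fintype.sum_prod_type]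
      have hcons : ∀ p : Option J × (Fin n → Option J),
          List.ofFn (Fin.consEquiv (fun _ => Option J) p) = p.1 :: List.ofFn p.2 :=
        fun p => List.ofFn_cons _ _
      simp only [hcons]
      set o := sel (K.piecewise c x) with ho
      set K' := knownAfter ev K (K.piecewise c x) o with hK'
      have hI := ih o K' (mask K' x) (S ∩ K') K' n (Nat.le_of_succ_le_succ hn)
      have hlen : (SelStrategy.step sel c next).len ev S x K
          = (next o K' (mask K' x) (S ∩ K')).len ev S x K' + 1 := rfl
      have hfin : (SelStrategy.step sel c next).final ev S x K
          = (next o K' (mask K' x) (S ∩ K')).final ev S x K' := rfl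
      rw [hlen, hfin]
      set N := (next o K' (mask K' x) (S ∩ K')).len ev S x K'
      set L := (S ∩ (next o K' (mask K' x) (S ∩ K')).final ev S x K').card
      clear_value N L
      clear_value K'
      clear_value o
      have hterm : (1 / 4 : ℝ) * ∑ l : Fin n → Option J,
          ((1 / 4 : ℝ) ^ ((next o K' (mask K' x) (S ∩ K')).withChoices K' (mask K' x) (S ∩ K')
            (List.ofFn l)).len ev S x K' *
          2 ^ (S ∩ ((next o K' (mask K' x) (S ∩ K')).withChoices K' (mask K' x) (S ∩ K')
            (List.ofFn l)).final ev S x K').card)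
        ≤ ∑ l : Fin n → Option J,
          ((1 / 4 : ℝ) ^ ((SelStrategy.step sel c next).withChoices K (mask K x) (S ∩ K)
            (o :: List.ofFn l)).len ev S x K *
          2 ^ (S ∩ ((SelStrategy.step sel c next).withChoices K (mask K x) (S ∩ K)
            (o :: List.ofFn l)).final ev S x K).card) := by
        rw [Finset.mul_sum]
        refine Finset.sum_le_sum fun l _ => ?_
        cases o with
        | none =>
          subst hK'
          simp only [SelStrategy.withChoices]
          exact mul_le_of_le_one_left (by positivity) (by norm_num)
        | some j =>
          subst hK'
          simp only [SelStrategy.withChoices, knownAfter, Strategy.len, Strategy.final]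
          rw [pow_succ]
          exact le_of_eq (by ring)
      have hsingle := Finset.single_le_sum (f := fun o : Option J => ∑ l : Fin n → Option J,
          ((1 / 4 : ℝ) ^ ((SelStrategy.step sel c next).withChoices K (mask K x) (S ∩ K)
            (o :: List.ofFn l)).len ev S x K *
          2 ^ (S ∩ ((SelStrategy.step sel c next).withChoices K (mask K x) (S ∩ K)
            (o :: List.ofFn l)).final ev S x K).card)) (fun _ _ => by positivity)
          (Finset.mem_univ o)
      have := mul_le_mul_of_nonneg_left hI
        (show (0 : ℝ) ≤ (Fintype.card (Option J) : ℝ)⁻¹ * (1 / 4) by positivity)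
      have h2 := mul_le_mul_of_nonneg_left (hterm.trans hsingle)
        (show (0 : ℝ) ≤ ((Fintype.card (Option J) : ℝ)⁻¹) ^ (n + 1) by positivity)
      refine le_trans (le_of_eq ?_) (this.trans (le_trans (le_of_eq ?_) h2))
      · rw [pow_succ, pow_succ]
        ring
      · rw [pow_succ]
        ring

end Choices

namespace RandomEvaluator

variable {h : J → (V → Bool) → Bool}

/-- Guessing worsens the discount per step from 1/4 to 1/(4M), with M the number of choices. Taking
the power θ with (4M)^θ = 4 restores it, at the price of the base 2^θ. -/
theorem selBound_of_strategyBound [Fintype J] (E : RandomEvaluator h) (hE : E.StrategyBound)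
    {θ : ℝ} (hθ0 : 0 ≤ θ) (hθ1 : θ ≤ 1)
    (hθ : (4 * (Fintype.card (Option J) : ℝ)) ^ θ = 4) : E.SelBound (2 ^ θ) := by
  intro st
  have hM : (0 : ℝ) < Fintype.card (Option J) := by exact_mod_cast Fintype.card_pos
  set M : ℝ := (Fintype.card (Option J) : ℝ) with hMdef
  obtain ⟨n, hn⟩ : ∃ n, ∀ ω x, st.len (E.ev ω) (E.S ω) x ∅ ≤ n :=
    ⟨Finset.univ.sup fun p : E.Ω × (V → Bool) => st.len (E.ev p.1) (E.S p.1) p.2 ∅, fun ω x =>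
      Finset.le_sup (f := fun p : E.Ω × (V → Bool) => st.len (E.ev p.1) (E.S p.1) p.2 ∅)
        (Finset.mem_univ (ω, x))⟩
  have hsum : ∑ ω, E.P ω * ∑ x : V → Bool, ((M⁻¹) ^ st.len (E.ev ω) (E.S ω) x ∅ *
      ((1 / 4 : ℝ) ^ st.len (E.ev ω) (E.S ω) x ∅ *
        2 ^ (E.S ω ∩ st.final (E.ev ω) (E.S ω) x ∅).card)) ≤ 2 ^ Fintype.card V := by
    calc _ ≤ ∑ ω, E.P ω * ∑ x : V → Bool, ((M⁻¹) ^ n * ∑ l : Fin n → Option J,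
          ((1 / 4 : ℝ) ^ (st.withChoices ∅ (fun _ => false) ∅ (List.ofFn l)).len
              (E.ev ω) (E.S ω) x ∅ *
            2 ^ (E.S ω ∩ (st.withChoices ∅ (fun _ => false) ∅ (List.ofFn l)).final
              (E.ev ω) (E.S ω) x ∅).card)) := by
          refine Finset.sum_le_sum fun ω _ => mul_le_mul_of_nonneg_left
            (Finset.sum_le_sum fun x _ => ?_) (E.P_nonneg ω)
          have := st.le_sum_withChoices (ev := E.ev ω) (S := E.S ω) x ∅ n (hn ω x)
          have hmask : mask ∅ x = fun _ => false := by simp [mask]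
          rw [hmask, Finset.inter_empty] at this
          exact this
      _ = (M⁻¹) ^ n * ∑ l : Fin n → Option J, ∑ ω, E.P ω * ∑ x : V → Bool,
          ((1 / 4 : ℝ) ^ (st.withChoices ∅ (fun _ => false) ∅ (List.ofFn l)).len
              (E.ev ω) (E.S ω) x ∅ *
            2 ^ (E.S ω ∩ (st.withChoices ∅ (fun _ => false) ∅ (List.ofFn l)).final
              (E.ev ω) (E.S ω) x ∅).card) := by
          rw [Finset.sum_comm, Finset.mul_sum]
          refine Finset.sum_congr rfl fun ω _ => ?_
          rw [← Finset.mul_sum, ← Finset.mul_sum, Finset.sum_comm]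
          ring
      _ ≤ (M⁻¹) ^ n * ∑ l : Fin n → Option J, 2 ^ Fintype.card V :=
          mul_le_mul_of_nonneg_left (Finset.sum_le_sum fun l _ => hE _) (by positivity)
      _ = 2 ^ Fintype.card V := by
          rw [Finset.sum_const, Finset.card_univ, Fintype.card_fun, Fintype.card_fin,
            nsmul_eq_mul, Nat.cast_pow, ← hMdef, ← mul_assoc, ← mul_pow, inv_mul_cancel₀ hM.ne',
            one_pow, one_mul]
  -- Weighted AM-GM in the form y^θ ≤ θ y + (1 - θ), with y the guessed term.
  have hpt : ∀ N L : ℕ, (1 / 4 : ℝ) ^ N * ((2 : ℝ) ^ θ) ^ L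
      ≤ θ * ((M⁻¹) ^ N * ((1 / 4 : ℝ) ^ N * 2 ^ L)) + (1 - θ) := by
    intro N L
    have h := Real.geom_mean_le_arith_mean2_weighted hθ0 (sub_nonneg.2 hθ1)
      (show (0 : ℝ) ≤ (M⁻¹) ^ N * ((1 / 4 : ℝ) ^ N * 2 ^ L) by positivity) zero_le_one (by ring)
    rw [Real.one_rpow, mul_one, mul_one] at h
    refine le_trans (le_of_eq ?_) h
    have e1 : (M⁻¹) ^ N * ((1 / 4 : ℝ) ^ N * 2 ^ L) = ((4 * M)⁻¹) ^ N * 2 ^ L := by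
      rw [mul_inv, mul_pow, one_div]
      ring
    rw [e1, Real.mul_rpow (by positivity) (by positivity), ← Real.rpow_natCast (4 * M)⁻¹ N,
      ← Real.rpow_natCast 2 L, ← Real.rpow_mul (by positivity), ← Real.rpow_mul (by positivity),
      mul_comm (N : ℝ), mul_comm (L : ℝ), Real.rpow_mul (by positivity),
      Real.rpow_mul (by positivity), Real.inv_rpow (by positivity), hθ, Real.rpow_natCast,
      Real.rpow_natCast, one_div]
  calc _ ≤ ∑ ω, E.P ω * ∑ x : V → Bool, (θ * ((M⁻¹) ^ st.len (E.ev ω) (E.S ω) x ∅ *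
      ((1 / 4 : ℝ) ^ st.len (E.ev ω) (E.S ω) x ∅ *
        2 ^ (E.S ω ∩ st.final (E.ev ω) (E.S ω) x ∅).card)) + (1 - θ)) :=
        Finset.sum_le_sum fun ω _ => mul_le_mul_of_nonneg_left
            (Finset.sum_le_sum fun x _ => hpt _ _) (E.P_nonneg ω)
    _ = θ * (∑ ω, E.P ω * ∑ x : V → Bool, ((M⁻¹) ^ st.len (E.ev ω) (E.S ω) x ∅ *
      ((1 / 4 : ℝ) ^ st.len (E.ev ω) (E.S ω) x ∅ *
        2 ^ (E.S ω ∩ st.final (E.ev ω) (E.S ω) x ∅).card)))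
        + (1 - θ) * 2 ^ Fintype.card V := by
        simp only [Finset.sum_add_distrib, mul_add, ← Finset.mul_sum, Finset.sum_const,
          Finset.card_univ, Fintype.card_fun, Fintype.card_bool, nsmul_eq_mul, ← Finset.sum_mul,
          E.P_sum, one_mul]
        congr 1
        · rw [Finset.mul_sum]
          exact Finset.sum_congr rfl fun ω _ => by ring
        · push_cast
          ring
    _ ≤ θ * 2 ^ Fintype.card V + (1 - θ) * 2 ^ Fintype.card V := by
        gcongr
    _ = _ := by ring

end RandomEvaluator

/-! ### From certificates to sensitivity, and the base layer. -/

/-- The coordinates to which `g` is sensitive at `x`. -/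
def sensitiveSet (g : (V → Bool) → Bool) (x : V → Bool) : Finset V :=
  Finset.univ.filter fun v => g (Function.update x v (!x v)) ≠ g x

namespace RandomEvaluator

variable {h : J → (V → Bool) → Bool}

/-- The exponential moments of the live set are those of a set in which each coordinate lies
independently with probability `Q`. -/
def HasRate (E : RandomEvaluator h) (Q : ℝ) : Prop :=
  ∀ (B : Finset V) (c : ℝ), ∑ ω, E.P ω * (1 + c) ^ (B ∩ E.S ω).card = (1 + Q * c) ^ B.card

theorem sum_starWeight_mul_pow (q c : ℝ) (B : Finset V) :
    ∑ R : V → Bool, starWeight q R * (1 + c) ^ (B.filter fun v => R v = true).card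
      = (1 + q * c) ^ B.card := by
  have h1 : ∀ R : V → Bool, starWeight q R * (1 + c) ^ (B.filter fun v => R v = true).card
      = ∏ v, (if R v then q else 1 - q) * (if v ∈ B ∧ R v = true then 1 + c else 1) := by
    intro R
    rw [Finset.prod_mul_distrib, ← starWeight, ← Finset.prod_filter, Finset.prod_const]
    congr 3
    ext v
    simp
  simp only [h1]
  rw [← Fintype.piFinset_univ, ← Finset.prod_univ_sum (fun _ => Finset.univ)
    (fun (v : V) (b : Bool) => (if b then q else 1 - q) * (if v ∈ B ∧ b = true then 1 + c else 1))]
  have h2 : (1 + q * c) ^ B.card = ∏ v, if v ∈ B then 1 + q * c else 1 := by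
    rw [Finset.prod_ite_mem, Finset.univ_inter, Finset.prod_const]
  rw [h2]
  refine Finset.prod_congr rfl fun v _ => ?_
  by_cases hv : v ∈ B
  · simp [hv]
    ring
  · simp [hv]

/-- Independent thinning multiplies the rates. -/
theorem HasRate.disj {E : RandomEvaluator h} {Q : ℝ} (hE : E.HasRate Q) (T : I → Set (J × Bool))
    {q : ℝ} (hq : 0 ≤ q) (hq1 : q ≤ 1) : (E.disj T hq hq1).HasRate (Q * q) := by
  intro B c
  change ∑ p : E.Ω × (V → Bool), E.P p.1 * starWeight q p.2 *
    (1 + c) ^ (B ∩ (E.S p.1).filter fun v => p.2 v = true).card = _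
  rw [Fintype.sum_prod_type, mul_assoc, ← hE B (q * c)]
  refine Finset.sum_congr rfl fun ω _ => ?_
  have hB : ∀ R : V → Bool, B ∩ (E.S ω).filter (fun v => R v = true)
      = (B ∩ E.S ω).filter fun v => R v = true := fun R => by rw [Finset.inter_filter]
  simp only [hB, mul_assoc, ← Finset.mul_sum, sum_starWeight_mul_pow]

theorem sum_pow_sensitiveSet_le {E : RandomEvaluator h} {Q : ℝ} (hE : E.StrategyBound)
    (hQ : E.HasRate Q) (j : J) :
    ∑ x : V → Bool, (1 + Q) ^ (sensitiveSet (h j) x).card ≤ 4 * 2 ^ Fintype.card V := by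
  -- A single examination is enough; its discount 1/4 is the source of the constant 4.
  have hb := hE (.step j (fun _ => false) fun _ _ _ => .halt)
  simp only [Strategy.len, Strategy.final, Finset.piecewise_empty, Finset.empty_union, zero_add,
    pow_one] at hb
  -- Flipping a live coordinate outside the certificate cannot change the certified value.
  have hsub : ∀ ω x, sensitiveSet (h j) x ∩ E.S ω ⊆ E.S ω ∩ E.ev ω j x ∅ := by
    intro ω x v hv
    rw [Finset.mem_inter] at hv ⊢
    refine ⟨hv.2, ?_⟩
    by_contra hne
    refine (Finset.mem_filter.1 hv.1).2 (E.cert ω j x (Function.update x v (!x v)) ∅ ?_).2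
    intro u hu
    refine Function.update_of_ne ?_ _ _
    rintro rfl
    rcases hu with hu | hu | hu
    · simp at hu
    · exact hu hv.2
    · exact hne hu
  have hrate : ∀ x, (1 + Q) ^ (sensitiveSet (h j) x).card
      = ∑ ω, E.P ω * 2 ^ (sensitiveSet (h j) x ∩ E.S ω).card := by
    intro x
    have := hQ (sensitiveSet (h j) x) 1
    rw [mul_one, one_add_one_eq_two] at this
    exact this.symm
  calc _ = ∑ ω, E.P ω * ∑ x : V → Bool, (2 : ℝ) ^ (sensitiveSet (h j) x ∩ E.S ω).card := by
        simp only [hrate, Finset.mul_sum]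
        exact Finset.sum_comm
    _ ≤ ∑ ω, E.P ω * ∑ x : V → Bool, (2 : ℝ) ^ (E.S ω ∩ E.ev ω j x ∅).card :=
        Finset.sum_le_sum fun ω _ => mul_le_mul_of_nonneg_left (Finset.sum_le_sum fun x _ =>
          pow_le_pow_right₀ (by norm_num) (Finset.card_le_card (hsub ω x))) (E.P_nonneg ω)
    _ = 4 * ∑ ω, E.P ω * ∑ x : V → Bool, (1 / 4 * (2 : ℝ) ^ (E.S ω ∩ E.ev ω j x ∅).card) := by
        simp only [← Finset.mul_sum]
        rw [Finset.mul_sum]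
        refine Finset.sum_congr rfl fun ω _ => ?_
        ring
    _ ≤ _ := mul_le_mul_of_nonneg_left hb (by norm_num)

/-- The evaluator of functions of one coordinate each. -/
def ofCoord (coord : J → V) (hdep : ∀ j x x', x' (coord j) = x (coord j) → h j x' = h j x) :
    RandomEvaluator h where
  Ω := Unit
  P _ := 1
  P_nonneg _ := zero_le_one
  P_sum := by simp
  S _ := Finset.univ
  ev _ j _ _ := {coord j}
  cert _ j x x' K hx := ⟨rfl, hdep j x x' (hx _ (Or.inr (Or.inr (Finset.mem_singleton_self _))))⟩

theorem hasRate_ofCoord (coord : J → V)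
    (hdep : ∀ j x x', x' (coord j) = x (coord j) → h j x' = h j x) :
    (ofCoord coord hdep).HasRate 1 := by
  intro B c
  change ∑ ω : Unit, 1 * (1 + c) ^ (B ∩ Finset.univ).card = _
  simp

/-- Each step reveals at most one coordinate, so the base 4 is exactly offset by the discount 1/4.
-/
theorem selBound_ofCoord (coord : J → V)
    (hdep : ∀ j x x', x' (coord j) = x (coord j) → h j x' = h j x) :
    (ofCoord coord hdep).SelBound 4 := by
  intro st
  change ∑ ω : Unit, 1 * ∑ x : V → Bool,
    ((1 / 4 : ℝ) ^ st.len (fun j _ _ => {coord j}) Finset.univ x ∅ *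
      4 ^ (Finset.univ ∩ st.final (fun j _ _ => {coord j}) Finset.univ x ∅).card) ≤ _
  have key : ∀ (x : V → Bool) (st : SelStrategy J V) (K : Finset V),
      (st.final (fun j _ _ => {coord j}) Finset.univ x K).card
        ≤ K.card + st.len (fun j _ _ => {coord j}) Finset.univ x K := by
    intro x st
    induction st with
    | halt => exact fun K => le_rfl
    | step sel c next ih =>
      intro K
      rw [SelStrategy.final, SelStrategy.len]
      refine (ih _ _ _ _ _).trans ?_
      have : (knownAfter (fun j _ _ => {coord j}) K (K.piecewise c x)
          (sel (K.piecewise c x))).card ≤ K.card + 1 := by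
        cases sel (K.piecewise c x) with
        | none => exact Nat.le_succ _
        | some j => exact (Finset.card_union_le _ _).trans (by simp)
      omega
  have hx : ∀ x : V → Bool, ((1 / 4 : ℝ) ^ st.len (fun j _ _ => {coord j}) Finset.univ x ∅ *
      4 ^ (Finset.univ ∩ st.final (fun j _ _ => {coord j}) Finset.univ x ∅).card) ≤ 1 := by
    intro x
    rw [Finset.univ_inter]
    have h1 := key x st ∅
    rw [Finset.card_empty, zero_add] at h1
    calc _ ≤ (1 / 4 : ℝ) ^ st.len (fun j _ _ => {coord j}) Finset.univ x ∅ *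
          4 ^ st.len (fun j _ _ => {coord j}) Finset.univ x ∅ :=
          mul_le_mul_of_nonneg_left (pow_le_pow_right₀ (by norm_num) h1) (by positivity)
      _ = 1 := by rw [← mul_pow]; norm_num
  simpa using Finset.sum_le_sum fun x (_ : x ∈ Finset.univ) => hx x

end RandomEvaluator

/-! ### Iterating over the layers, with the choice of constants. -/

/-- Bernoulli's inequality (1/2)^θ ≤ 1 - θ/2. It makes the letter weight w = θ/4 admissible for the
base 2^θ. -/
theorem two_rpow_neg_le {θ : ℝ} (h0 : 0 ≤ θ) (h1 : θ ≤ 1) : 1 ≤ (1 - 2 * (θ / 4)) * 2 ^ θ := by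
  have h := rpow_one_add_le_one_add_mul_self (s := -1 / 2) (by norm_num) h0 h1
  have h2 : ((1 + -1 / 2 : ℝ)) ^ θ * 2 ^ θ = 1 := by
    rw [← Real.mul_rpow (by norm_num) (by norm_num)]
    norm_num
  have h3 : (0 : ℝ) < 2 ^ θ := by positivity
  nlinarith

/-- Layers of disjunctions of signed functions, over functions of one coordinate each, have random
evaluators. -/
theorem exists_randomEvaluator [Fintype I] {s : ℕ} (hs : 2 ≤ s) (hI : Fintype.card I ≤ s)
    {h₀ : J → (V → Bool) → Bool} (coord : J → V)
    (hdep : ∀ j x x', x' (coord j) = x (coord j) → h₀ j x' = h₀ j x)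
    (h : ℕ → I → (V → Bool) → Bool)
    (hone : ∀ i, ∃ T : Set (J × Bool), ∀ x, h 1 i x = true ↔ ∃ p ∈ T, h₀ p.1 x = p.2)
    (hsucc : ∀ e, 1 ≤ e → ∀ i, ∃ T : Set (I × Bool), ∀ x,
      h (e + 1) i x = true ↔ ∃ p ∈ T, h e p.1 x = p.2) (e : ℕ) :
    ∃ E : RandomEvaluator (h (e + 1)), E.StrategyBound ∧
      E.HasRate (1 / 32 * (1 / (64 * Real.logb 2 s)) ^ e) := by
  classical
  have hs' : (2 : ℝ) ≤ s := by exact_mod_cast hs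
  have hl2 : 0 < Real.log 2 := Real.log_pos (by norm_num)
  have hls : Real.log 2 ≤ Real.log s := Real.log_le_log (by norm_num) hs'
  have hell : 1 ≤ Real.logb 2 s := by
    rw [Real.logb, le_div_iff₀ hl2]
    linarith
  induction e with
  | zero =>
    choose T hT using hone
    have heq : (fun (i : I) (x : V → Bool) => decide (∃ p ∈ T i, h₀ p.1 x = p.2)) = h 1 := by
      funext i x
      rw [Bool.eq_iff_iff, decide_eq_true_iff, hT]
    rw [zero_add, ← heq, pow_zero, mul_one]
    have h0 : (0 : ℝ) ≤ 1 / 32 := by norm_num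
    have h1 : (1 / 32 : ℝ) ≤ 1 := by norm_num
    -- With base a = 4, the weight w = 3/8 makes `(1 - 2 * w) * a` exactly 1.
    refine ⟨(RandomEvaluator.ofCoord coord hdep).disj T h0 h1,
      RandomEvaluator.strategyBound_disj _ T (w := 3 / 8) h0 h1 (by norm_num) (by norm_num)
        (by norm_num) (by norm_num) (RandomEvaluator.selBound_ofCoord coord hdep), ?_⟩
    have := (RandomEvaluator.hasRate_ofCoord coord hdep).disj T h0 h1
    rwa [one_mul] at this
  | succ e ih =>
    obtain ⟨E, hE, hR⟩ := ih
    choose T hT using hsucc (e + 1) (Nat.le_add_left _ _)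
    have heq : (fun (i : I) (x : V → Bool) =>
        @decide (∃ p ∈ T i, h (e + 1) p.1 x = p.2) (Classical.propDecidable _))
        = h (e + 1 + 1) := by
      funext i x
      rw [Bool.eq_iff_iff, hT]
      exact @decide_eq_true_iff _ (Classical.propDecidable _)
    rw [← heq]
    have hM1 : (1 : ℝ) ≤ Fintype.card (Option I) := by exact_mod_cast Fintype.card_pos
    have hMs : (Fintype.card (Option I) : ℝ) ≤ s + 1 := by
      rw [Fintype.card_option]
      exact_mod_cast Nat.succ_le_succ hI
    set M : ℝ := (Fintype.card (Option I) : ℝ)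
    have hlogM : Real.log 4 ≤ Real.log (4 * M) := Real.log_le_log (by norm_num) (by linarith)
    have hlog4 : Real.log 4 = 2 * Real.log 2 := by
      rw [show (4 : ℝ) = 2 ^ 2 by norm_num, Real.log_pow]
      norm_num
    -- 4(s + 1) ≤ s⁴ for s ≥ 2. This gives θ ≥ 1/(2 log₂ s), and then 8q ≤ θ/4 for q = 1/(64 log₂
    -- s).
    have hlogMs : Real.log (4 * M) ≤ 4 * Real.log s := by
      have : 4 * Real.log s = Real.log ((s : ℝ) ^ 4) := by rw [Real.log_pow]; norm_num
      rw [this]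
      refine Real.log_le_log (by linarith) ?_
      have h3 : (8 : ℝ) ≤ (s : ℝ) ^ 3 := by
        calc (8 : ℝ) = 2 ^ 3 := by norm_num
          _ ≤ (s : ℝ) ^ 3 := pow_le_pow_left₀ (by norm_num) hs' 3
      nlinarith
    have hθ0 : 0 ≤ Real.logb (4 * M) 4 :=
      div_nonneg (by linarith) (by linarith)
    have hθ1 : Real.logb (4 * M) 4 ≤ 1 := (div_le_one (by linarith)).2 hlogM
    have hθ : (4 * M) ^ Real.logb (4 * M) 4 = 4 :=
      Real.rpow_logb (by linarith) (by linarith) (by norm_num)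
    have hθl : 1 / (2 * Real.logb 2 s) ≤ Real.logb (4 * M) 4 := by
      rw [Real.logb, Real.logb, div_le_div_iff₀ (by positivity) (by linarith), hlog4]
      have : 2 * Real.log 2 * (2 * (Real.log s / Real.log 2)) = 4 * Real.log s := by
        field_simp
        ring
      linarith
    have hS := E.selBound_of_strategyBound hE hθ0 hθ1 hθ
    have hq : 0 ≤ 1 / (64 * Real.logb 2 s) := by positivity
    have hq1 : 1 / (64 * Real.logb 2 s) ≤ 1 := by
      rw [div_le_one (by positivity)]
      linarith
    have hwq : 8 * (1 / (64 * Real.logb 2 s)) ≤ Real.logb (4 * M) 4 / 4 := by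
      have : 8 * (1 / (64 * Real.logb 2 s)) = 1 / (2 * Real.logb 2 s) / 4 := by
        field_simp
        norm_num
      linarith
    refine ⟨E.disj T hq hq1, E.strategyBound_disj T hq hq1 hwq (by linarith)
      (Real.one_le_rpow (by norm_num) hθ0) (two_rpow_neg_le hθ0 hθ1) hS, ?_⟩
    rw [pow_succ, ← mul_assoc]
    exact hR.disj T hq hq1

theorem card_sensitiveSet_le_one {g : (V → Bool) → Bool} {x : V → Bool} {v : V}
    (hv : ∀ y : V → Bool, y v = x v → g y = g x) : (sensitiveSet g x).card ≤ 1 := by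
  rw [← Finset.card_singleton v]
  refine Finset.card_le_card fun u hu => ?_
  rw [Finset.mem_singleton]
  by_contra hne
  exact (Finset.mem_filter.1 hu).2 (hv _ (Function.update_of_ne (Ne.symm hne) _ _))

/-! ### Depth one, where the full rate Q = 1 is needed. -/

/-- The exponential moment of the sensitivity of a disjunction of functions of one coordinate. -/
theorem sum_two_pow_sensitiveSet_le {g : (V → Bool) → Bool} (φ : V → Bool → Prop)
    (hg : ∀ x, g x = true ↔ ∃ v, φ v (x v)) :
    ∑ x : V → Bool, (2 : ℝ) ^ (sensitiveSet g x).card ≤ 4 * 2 ^ Fintype.card V := by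
  classical
  have hfalse : ∑ x ∈ Finset.univ.filter (fun x : V → Bool => g x = false),
      2 ^ (sensitiveSet g x).card ≤ 2 ^ Fintype.card V := by
    have h1 : ∀ x : V → Bool, 2 ^ (sensitiveSet g x).card = ((sensitiveSet g x).powerset).card :=
      fun x => (Finset.card_powerset _).symm
    simp only [h1]
    rw [← Finset.card_sigma]
    have hcard : Fintype.card (V → Bool) = 2 ^ Fintype.card V := by simp
    rw [← hcard, ← Finset.card_univ]
    refine Finset.card_le_card_of_injOn
      (fun p => fun v => if v ∈ p.2 then !p.1 v else p.1 v) (fun _ _ => Finset.mem_univ _) ?_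
    -- At a false point no disjunct holds, so flipping a set of sensitive coordinates makes true
    -- disjuncts appear exactly on that set. The set, hence the point, can be read off the flipped
    -- input.
    have hrec : ∀ p : (_ : V → Bool) × Finset V, p ∈ (Finset.univ.filter
        (fun x : V → Bool => g x = false)).sigma (fun x => (sensitiveSet g x).powerset) →
        ∀ v, v ∈ p.2 ↔ φ v (if v ∈ p.2 then !p.1 v else p.1 v) := by
      intro p hp v
      rw [Finset.mem_sigma, Finset.mem_filter, Finset.mem_powerset] at hp
      have hno : ∀ u, ¬ φ u (p.1 u) := fun u hu => by
        have := (hg p.1).2 ⟨u, hu⟩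
        rw [hp.1.2] at this
        exact Bool.noConfusion this
      by_cases hv : v ∈ p.2
      · rw [if_pos hv]
        refine iff_of_true hv ?_
        have hs := (Finset.mem_filter.1 (hp.2 hv)).2
        rw [hp.1.2, ne_eq, Bool.not_eq_false, hg] at hs
        obtain ⟨u, hu⟩ := hs
        by_cases huv : u = v
        · subst huv
          rwa [Function.update_self] at hu
        · rw [Function.update_of_ne huv] at hu
          exact absurd hu (hno u)
      · rw [if_neg hv]
        exact iff_of_false hv (hno v)
    rintro ⟨x₁, D₁⟩ h₁ ⟨x₂, D₂⟩ h₂ heq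
    have hD : D₁ = D₂ := by
      ext v
      have e₁ := hrec _ h₁ v
      have e₂ := hrec _ h₂ v
      have := congrFun heq v
      dsimp only at e₁ e₂ this
      rw [e₁, e₂, this]
    subst hD
    have hx : x₁ = x₂ := by
      funext v
      have := congrFun heq v
      dsimp only at this
      by_cases hv : v ∈ D₁
      · rw [if_pos hv, if_pos hv] at this
        exact Bool.not_inj this
      · rwa [if_neg hv, if_neg hv] at this
    rw [hx]
  have htrue : ∀ x, g x = true → (sensitiveSet g x).card ≤ 1 := by
    intro x hx
    obtain ⟨v, hv⟩ := (hg x).1 hx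
    refine card_sensitiveSet_le_one (v := v) fun y hy => ?_
    rw [hx, hg]
    exact ⟨v, by rwa [hy]⟩
  have hfalse' : ∑ x ∈ Finset.univ.filter (fun x : V → Bool => g x = false),
      (2 : ℝ) ^ (sensitiveSet g x).card ≤ 2 ^ Fintype.card V := by exact_mod_cast hfalse
  calc _ ≤ ∑ x : V → Bool, (2 + if g x = false then (2 : ℝ) ^ (sensitiveSet g x).card else 0) := by
        refine Finset.sum_le_sum fun x _ => ?_
        cases hx : g x with
        | false => simp
        | true =>
          have := pow_le_pow_right₀ (one_le_two (α := ℝ)) (htrue x hx)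
          simpa using this
    _ = 2 * 2 ^ Fintype.card V + ∑ x ∈ Finset.univ.filter (fun x : V → Bool => g x = false),
      (2 : ℝ) ^ (sensitiveSet g x).card := by
        rw [Finset.sum_add_distrib, ← Finset.sum_filter, Finset.sum_const, Finset.card_univ]
        simp [mul_comm]
    _ ≤ _ := by
        have : (0 : ℝ) < 2 ^ Fintype.card V := by positivity
        linarith

end Switching

/-! ### Circuits as layers of signed disjunctions. -/

/-- The functions `N a` of depth `dep a` are, up to sign, literals or members of layers `h`, where
every layer consists of disjunctions of signed functions of the layer below. -/
structure Layering {ι I α : Type} (N : α → (ι → Bool) → Bool) (dep : α → ℕ)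
    (h : ℕ → I → (ι → Bool) → Bool) : Prop where
  one : ∀ i, ∃ T : Set (ι × Bool), ∀ x, h 1 i x = true ↔ ∃ p ∈ T, x p.1 = p.2
  succ : ∀ e, 1 ≤ e → ∀ i, ∃ T : Set (I × Bool), ∀ x,
    h (e + 1) i x = true ↔ ∃ p ∈ T, h e p.1 x = p.2
  node : ∀ a, (dep a = 0 ∧ ∃ v b, ∀ x, N a x = (x v == b)) ∨
    (1 ≤ dep a ∧ ∃ i b, ∀ e, dep a ≤ e → ∀ x, N a x = (h e i x == b))

section Layering

variable {ι I α : Type} {N : α → (ι → Bool) → Bool} {dep : α → ℕ} {h : ℕ → I → (ι → Bool) → Bool}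

open scoped Classical in
/-- The layers, with one further function: the disjunction of the functions in `S` with sign `c`,
represented in the lower layers by its part of depth zero. -/
noncomputable def insertLayer (N : α → (ι → Bool) → Bool) (dep : α → ℕ)
    (h : ℕ → I → (ι → Bool) → Bool) (S : Finset α) (c : Bool) (e : ℕ) (i : Option I)
    (x : ι → Bool) : Bool :=
  match i with
  | some i => h e i x
  | none => decide (∃ a ∈ S, (S.sup dep + 1 ≤ e ∨ dep a = 0) ∧ N a x = c)

theorem Layering.exists_literal (L : Layering N dep h) {a : α} (ha : dep a = 0) (c : Bool) :
    ∃ v b, ∀ x : ι → Bool, N a x = c ↔ x v = b := by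
  rcases L.node a with ⟨_, v, b, H⟩ | ⟨h1, _⟩
  · refine ⟨v, b == c, fun x => ?_⟩
    rw [H]
    cases x v <;> cases b <;> cases c <;> decide
  · omega

theorem Layering.exists_index (L : Layering N dep h) {a : α} (ha : dep a ≠ 0) (c : Bool) {e : ℕ}
    (he : dep a ≤ e) : ∃ i b, ∀ x : ι → Bool, N a x = c ↔ h e i x = b := by
  rcases L.node a with ⟨h1, _⟩ | ⟨_, i, b, H⟩
  · omega
  · refine ⟨i, b == c, fun x => ?_⟩
    rw [H e he]
    cases h e i x <;> cases b <;> cases c <;> decide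

/-- Above layer one only the layer below may be read, not the inputs. A gate's literals are
therefore carried up from layer one under the gate's own index, and no index is spent on inputs. -/
theorem Layering.insert (L : Layering N dep h) (S : Finset α) (c b₀ : Bool) :
    Layering (α := Option α)
      (fun a x => a.elim (decide (∃ a ∈ S, N a x = c) == b₀) fun a => N a x)
      (fun a => a.elim (S.sup dep + 1) dep) (insertLayer N dep h S c) where
  one i := by
    cases i with
    | some i => exact L.one i
    | none =>
      refine ⟨{p | ∃ a ∈ S, dep a = 0 ∧ ∀ x : ι → Bool, N a x = c ↔ x p.1 = p.2}, fun x => ?_⟩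
      simp only [insertLayer, decide_eq_true_iff, Set.mem_ofPred_eq]
      constructor
      · rintro ⟨a, haS, hd, hx⟩
        have hd0 : dep a = 0 := by
          rcases hd with hd | hd
          · have := Finset.le_sup (f := dep) haS
            omega
          · exact hd
        obtain ⟨v, b, H⟩ := L.exists_literal hd0 c
        exact ⟨(v, b), ⟨a, haS, hd0, H⟩, (H x).1 hx⟩
      · rintro ⟨p, ⟨a, haS, hd0, H⟩, hp⟩
        exact ⟨a, haS, Or.inr hd0, (H x).2 hp⟩
  succ e he i := by
    cases i with
    | some i =>
      obtain ⟨T, hT⟩ := L.succ e he i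
      refine ⟨(fun p : I × Bool => (some p.1, p.2)) '' T, fun x => ?_⟩
      simp only [insertLayer, hT, Set.exists_mem_image]
    | none =>
      -- The gate copies itself from the previous layer, and at its own depth it also acquires its
      -- disjuncts of positive depth.
      refine ⟨{p | p = (none, true) ∨ ∃ a ∈ S, S.sup dep + 1 = e + 1 ∧ ∀ x : ι → Bool,
        N a x = c ↔ insertLayer N dep h S c e p.1 x = p.2}, fun x => ?_⟩
      constructor
      · intro hx
        simp only [insertLayer, decide_eq_true_iff] at hx
        obtain ⟨a, haS, hd, hx⟩ := hx
        by_cases hlow : S.sup dep + 1 ≤ e ∨ dep a = 0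
        · refine ⟨(none, true), Or.inl rfl, ?_⟩
          simp only [insertLayer, decide_eq_true_iff]
          exact ⟨a, haS, hlow, hx⟩
        · push Not at hlow
          have hD : S.sup dep + 1 = e + 1 := by
            rcases hd with hd | hd
            · omega
            · exact absurd hd hlow.2
          have := Finset.le_sup (f := dep) haS
          obtain ⟨i, b, H⟩ := L.exists_index hlow.2 c (e := e) (by omega)
          exact ⟨(some i, b), Or.inr ⟨a, haS, hD, H⟩, (H x).1 hx⟩
      · rintro ⟨p, rfl | ⟨a, haS, hD, H⟩, hp⟩
        · simp only [insertLayer, decide_eq_true_iff] at hp ⊢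
          obtain ⟨a, haS, hd, hx⟩ := hp
          exact ⟨a, haS, hd.imp_left fun h => h.trans (Nat.le_succ e), hx⟩
        · have := (H x).2 hp
          simp only [insertLayer, decide_eq_true_iff]
          exact ⟨a, haS, Or.inl hD.le, this⟩
  node a := by
    cases a with
    | some a =>
      refine (L.node a).imp_right fun ⟨h1, i, b, H⟩ => ⟨h1, some i, b, H⟩
    | none =>
      refine Or.inr ⟨Nat.le_add_left _ _, none, b₀, fun e he x => ?_⟩
      have he' : S.sup dep + 1 ≤ e := he
      simp only [insertLayer, he', true_or, true_and, Option.elim_none]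

theorem Layering.comp {β : Type} (L : Layering N dep h) (f : β → α) :
    Layering (fun b => N (f b)) (fun b => dep (f b)) h :=
  ⟨L.one, L.succ, fun b => L.node (f b)⟩

end Layering

namespace GateList

variable {ι : Type}

/-- The nodes of a list of gates, in terms of the last gate and the earlier nodes. -/
def splitLast {g : ℕ} : ι ⊕ Fin (g + 1) → Option (ι ⊕ Fin g)
  | .inl v => some (.inl v)
  | .inr k => Fin.lastCases none (fun k => some (.inr k)) k

theorem elim_snoc {g : ℕ} {β : Type} (f : ι → β) (u : Fin g → β) (t : β) (a : ι ⊕ Fin (g + 1)) :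
    Sum.elim f (Fin.snoc (α := fun _ => β) u t) a = (splitLast a).elim t (Sum.elim f u) := by
  rcases a with v | k
  · rfl
  · induction k using Fin.lastCases with
    | last => simp [splitLast]
    | cast k => simp [splitLast]

/-- De Morgan turns an AND gate into a negated disjunction of negations, and NOT gates vanish into
signs. Each AND or OR gate adds one index, so every layer has as many members as the circuit has
counted gates. -/
theorem exists_layering {g : ℕ} (P : GateList ι g) :
    ∃ (I : Type) (_ : Fintype I) (h : ℕ → I → (ι → Bool) → Bool), Fintype.card I = P.size ∧
      Layering (fun (a : ι ⊕ Fin g) x => Sum.elim x (P.val x) a)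
        (fun a => Sum.elim (fun _ => 0) P.depth a) h := by
  induction P with
  | nil =>
    refine ⟨Empty, inferInstance, fun _ i _ => i.elim, rfl, ⟨fun i => i.elim, fun _ _ i => i.elim,
      fun a => Or.inl ?_⟩⟩
    rcases a with v | k
    · exact ⟨rfl, v, true, fun x => by simp⟩
    · exact k.elim0
  | @snoc g P a ih =>
    obtain ⟨I, _, h, hcard, L⟩ := ih
    simp only [val, depth, elim_snoc]
    cases a with
    | and S =>
      refine ⟨Option I, inferInstance, insertLayer (fun a x => Sum.elim x (P.val x) a)
        (fun a => Sum.elim (fun _ => 0) P.depth a) h S false, ?_, ?_⟩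
      rotate_left
      · convert (L.insert S false false).comp splitLast using 3 with a x
        · simp only [Gate.eval]
          cases splitLast a with
          | some a => rfl
          | none =>
            rw [Bool.eq_iff_iff]
            simp
        · rfl
      · simp [size, Gate.size, hcard]
    | or S =>
      refine ⟨Option I, inferInstance, insertLayer (fun a x => Sum.elim x (P.val x) a)
        (fun a => Sum.elim (fun _ => 0) P.depth a) h S true, ?_, ?_⟩
      rotate_left
      · convert (L.insert S true true).comp splitLast using 3 with a x
        · simp only [Gate.eval]
          cases splitLast a with
          | some a => rfl
          | none => simp
        · rfl
      · simp [size, Gate.size, hcard]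
    | not a₀ =>
      refine ⟨I, inferInstance, h, hcard, L.one, L.succ, fun a => ?_⟩
      cases splitLast a with
      | some a => exact L.node a
      | none =>
        simp only [Option.elim_none, Gate.eval, Gate.depth]
        refine (L.node a₀).imp ?_ ?_
        · rintro ⟨h0, v, b, H⟩
          refine ⟨h0, v, !b, fun x => ?_⟩
          rw [H x]
          cases x v <;> cases b <;> rfl
        · rintro ⟨h0, i, b, H⟩
          refine ⟨h0, i, !b, fun e he x => ?_⟩
          rw [H e he x]
          cases h e i x <;> cases b <;> rfl

end GateList

/-! ### The moment bound for circuits. -/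

/-- The exponential moment of the sensitivity of a small circuit of bounded depth, each of whose
inputs is a function of one coordinate. -/
theorem BoolCircuit.sum_pow_sensitiveSet_le {ι V : Type} [Fintype V] [DecidableEq V]
    (c : BoolCircuit ι) {s d : ℕ} (hs : 2 ≤ s) (hd : 1 ≤ d) (hsize : c.size ≤ s)
    (hdepth : c.depth ≤ d) (coord : ι → V) (ψ : ι → Bool → Bool) :
    ∑ z : V → Bool, (1 + (1 / (2048 * Real.logb 2 s)) ^ (d - 1)) ^
      (sensitiveSet (fun z : V → Bool => c.eval fun a => ψ a (z (coord a))) z).card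
      ≤ 4 * 2 ^ Fintype.card V := by
  have hs' : (2 : ℝ) ≤ s := by exact_mod_cast hs
  have hell : 1 ≤ Real.logb 2 s := by
    rw [Real.le_logb_iff_rpow_le (by norm_num) (by linarith), Real.rpow_one]
    exact hs'
  have hQ0 : 0 ≤ 1 / (2048 * Real.logb 2 s) := by positivity
  have hQ1 : 1 / (2048 * Real.logb 2 s) ≤ 1 := by
    rw [div_le_one (by positivity)]
    linarith
  obtain ⟨I, _, h, hcard, L⟩ := c.gates.exists_layering
  rcases L.node c.output with ⟨_, v, b, H⟩ | ⟨_, i, b, H⟩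
  · have hg : (fun z : V → Bool => c.eval fun a => ψ a (z (coord a)))
        = fun z => (ψ v (z (coord v)) == b) := by
      funext z
      exact H _
    rw [hg]
    calc _ ≤ ∑ z : V → Bool, (4 : ℝ) := by
          refine Finset.sum_le_sum fun z _ => ?_
          have h1 : (sensitiveSet (fun z : V → Bool => (ψ v (z (coord v)) == b)) z).card ≤ 1 :=
            card_sensitiveSet_le_one (v := coord v) fun y hy => by simp only [hy]
          have h2 := pow_le_one₀ (n := d - 1) hQ0 hQ1
          have h3 := pow_nonneg hQ0 (d - 1)
          have := pow_le_pow_right₀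
            (show 1 ≤ 1 + (1 / (2048 * Real.logb 2 s)) ^ (d - 1) by linarith) h1
          rw [pow_one] at this
          linarith
      _ = 4 * 2 ^ Fintype.card V := by simp [mul_comm]
  · have hH : ∀ z : V → Bool, c.eval (fun a => ψ a (z (coord a)))
        = (h d i (fun a => ψ a (z (coord a))) == b) := fun z => H d hdepth _
    have hsens : ∀ z : V → Bool,
        sensitiveSet (fun z : V → Bool => c.eval fun a => ψ a (z (coord a))) z
          = sensitiveSet (fun z : V → Bool => h d i fun a => ψ a (z (coord a))) z := by
      intro z
      ext v
      simp only [sensitiveSet, Finset.mem_filter, Finset.mem_univ, true_and, hH]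
      generalize h d i (fun a => ψ a (Function.update z v (!z v) (coord a))) = p
      generalize h d i (fun a => ψ a (z (coord a))) = q
      cases p <;> cases q <;> cases b <;> decide
    simp only [hsens]
    obtain ⟨e, rfl⟩ : ∃ e, d = e + 1 := ⟨d - 1, by omega⟩
    rw [Nat.add_sub_cancel]
    -- Depth one is separate because the evaluator has rate only 1/32 there. From depth two on, 2048
    -- = 32 · 64 absorbs that factor.
    cases e with
    | zero =>
      obtain ⟨T, hT⟩ := L.one i
      simp only [pow_zero, one_add_one_eq_two, zero_add]
      refine sum_two_pow_sensitiveSet_le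
        (fun v t => ∃ p ∈ T, coord p.1 = v ∧ ψ p.1 t = p.2) fun z => ?_
      rw [hT]
      constructor
      · rintro ⟨p, hp, hx⟩
        exact ⟨coord p.1, p, hp, rfl, hx⟩
      · rintro ⟨v, p, hp, rfl, hx⟩
        exact ⟨p, hp, hx⟩
    | succ e =>
      obtain ⟨E, hE, hR⟩ := exists_randomEvaluator hs (hcard.trans_le hsize)
        (h₀ := fun (a : ι) (z : V → Bool) => ψ a (z (coord a))) coord
        (fun a x x' hx => by rw [hx]) (fun e i z => h e i fun a => ψ a (z (coord a)))
        (fun i => (L.one i).imp fun T hT z => hT _)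
        (fun e he i => (L.succ e he i).imp fun T hT z => hT _) (e + 1)
      refine le_trans (Finset.sum_le_sum fun z _ => ?_)
        (RandomEvaluator.sum_pow_sensitiveSet_le hE hR i)
      refine pow_le_pow_left₀ (by positivity) ?_ _
      have h1 : (1 / (2048 * Real.logb 2 s)) ^ (e + 1)
          = (1 / 32) ^ (e + 1) * (1 / (64 * Real.logb 2 s)) ^ (e + 1) := by
        rw [← mul_pow]
        congr 1
        field_simp
        norm_num
      rw [h1]
      have h2 : ((1 : ℝ) / 32) ^ (e + 1) ≤ 1 / 32 :=
        pow_le_of_le_one (by norm_num) (by norm_num) (Nat.succ_ne_zero e)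
      have h3 : (0 : ℝ) ≤ (1 / (64 * Real.logb 2 s)) ^ (e + 1) := by positivity
      linarith [mul_le_mul_of_nonneg_right h2 h3]

/-! ### Symmetrization on product spaces and the tail bound. -/

section Product

variable {κ α : Type} [Fintype κ] [DecidableEq κ] [Fintype α] {δ : α → ℝ}

theorem sum_prod_eq_one (hδ : ∑ a, δ a = 1) : ∑ x : κ → α, ∏ i, δ (x i) = 1 := by
  rw [← Fintype.piFinset_univ, ← Finset.prod_univ_sum (fun _ => Finset.univ) fun _ a => δ a]
  simp [hδ]

theorem sum_prod_mul_apply (hδ : ∑ a, δ a = 1) (i : κ) (F : α → ℝ) :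
    ∑ x : κ → α, (∏ j, δ (x j)) * F (x i) = ∑ a, δ a * F a := by
  have h1 : ∀ x : κ → α, (∏ j, δ (x j)) * F (x i)
      = ∏ j, δ (x j) * (if j = i then F (x j) else 1) := by
    intro x
    rw [Finset.prod_mul_distrib, Finset.prod_ite_eq' Finset.univ i fun j => F (x j),
      if_pos (Finset.mem_univ i)]
  simp only [h1]
  rw [← Fintype.piFinset_univ, ← Finset.prod_univ_sum (fun _ => Finset.univ)
    fun j a => δ a * (if j = i then F a else 1), Finset.prod_eq_single i]
  · simp
  · intro j _ hj
    simp [hj, hδ]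
  · simp

/-- The point that agrees with `b` where `z` holds, and with `a` elsewhere. -/
def mix (z : κ → Bool) (a b : κ → α) : κ → α := fun i => if z i then b i else a i

/-- Swapping a_i and b_i wherever z_i holds is an involution preserving the product weight. -/
theorem sum_mix (z : κ → Bool) (F : (κ → α) → (κ → α) → ℝ) :
    ∑ a : κ → α, ∑ b : κ → α, (∏ i, δ (a i)) * (∏ i, δ (b i)) * F (mix z a b) (mix z b a)
      = ∑ a : κ → α, ∑ b : κ → α, (∏ i, δ (a i)) * (∏ i, δ (b i)) * F a b := by
  have hmm : ∀ a b : κ → α, mix z (mix z a b) (mix z b a) = a := by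
    intro a b
    funext i
    cases hz : z i <;> simp [mix, hz]
  let e : (κ → α) × (κ → α) ≃ (κ → α) × (κ → α) :=
    ⟨fun p => (mix z p.1 p.2, mix z p.2 p.1), fun p => (mix z p.1 p.2, mix z p.2 p.1),
      fun p => Prod.ext (hmm _ _) (hmm _ _), fun p => Prod.ext (hmm _ _) (hmm _ _)⟩
  rw [← Fintype.sum_prod_type', ← Fintype.sum_prod_type', ← e.sum_comp]
  refine Finset.sum_congr rfl fun p _ => ?_
  have h1 : (∏ i, δ (p.1 i)) * (∏ i, δ (p.2 i))
      = (∏ i, δ (mix z p.1 p.2 i)) * (∏ i, δ (mix z p.2 p.1 i)) := by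
    rw [← Finset.prod_mul_distrib, ← Finset.prod_mul_distrib]
    refine Finset.prod_congr rfl fun i _ => ?_
    cases hz : z i <;> simp [mix, hz, mul_comm]
  simp only [e, Equiv.coe_fn_mk, h1, hmm]

/-- The coordinates `i` such that replacing `a i` by `b i` changes the value of `f` at `a`. -/
def changeSet (f : (κ → α) → Bool) (a b : κ → α) : Finset κ :=
  Finset.univ.filter fun i => f a ≠ f (Function.update a i (b i))

theorem changeSet_mix (f : (κ → α) → Bool) (z : κ → Bool) (a b : κ → α) :
    changeSet f (mix z a b) (mix z b a) = sensitiveSet (fun z => f (mix z a b)) z := by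
  ext i
  simp only [changeSet, sensitiveSet, Finset.mem_filter, Finset.mem_univ, true_and]
  have : mix (Function.update z i (!z i)) a b
      = Function.update (mix z a b) i (mix z b a i) := by
    funext j
    by_cases hj : j = i
    · subst hj
      cases hz : z j <;> simp [mix, hz]
    · simp [mix, hj]
  rw [this, ne_comm]

/-- The left side is unchanged by the swap along any z. Averaging over z and exchanging sums leaves
a sensitivity moment on the cube for each fixed pair (a, b). -/
theorem sum_pow_changeSet_le (hδ0 : ∀ a, 0 ≤ δ a) (hδ : ∑ a, δ a = 1) {u B : ℝ}
    (f : (κ → α) → Bool)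
    (hf : ∀ a b : κ → α, ∑ z : κ → Bool, u ^ (sensitiveSet (fun z => f (mix z a b)) z).card
      ≤ B * 2 ^ Fintype.card κ) :
    ∑ a : κ → α, ∑ b : κ → α, (∏ i, δ (a i)) * (∏ i, δ (b i)) * u ^ (changeSet f a b).card
      ≤ B := by
  have hnn : ∀ a : κ → α, 0 ≤ ∏ i, δ (a i) := fun a => Finset.prod_nonneg fun i _ => hδ0 _
  have h2 : (0 : ℝ) < 2 ^ Fintype.card κ := by positivity
  refine le_of_mul_le_mul_left ?_ h2
  calc _ = ∑ z : κ → Bool, ∑ a : κ → α, ∑ b : κ → α, (∏ i, δ (a i)) * (∏ i, δ (b i)) *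
        u ^ (changeSet f (mix z a b) (mix z b a)).card := by
        simp only [sum_mix _ fun a b => u ^ (changeSet f a b).card, Finset.sum_const,
          Finset.card_univ, Fintype.card_fun, Fintype.card_bool, nsmul_eq_mul]
        push_cast
        rfl
    _ = ∑ a : κ → α, ∑ b : κ → α, (∏ i, δ (a i)) * (∏ i, δ (b i)) *
        ∑ z : κ → Bool, u ^ (sensitiveSet (fun z => f (mix z a b)) z).card := by
        rw [Finset.sum_comm]
        refine Finset.sum_congr rfl fun a _ => ?_
        rw [Finset.sum_comm]
        simp only [changeSet_mix, Finset.mul_sum]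
    _ ≤ ∑ a : κ → α, ∑ b : κ → α, (∏ i, δ (a i)) * (∏ i, δ (b i)) *
        (B * 2 ^ Fintype.card κ) :=
        Finset.sum_le_sum fun a _ => Finset.sum_le_sum fun b _ =>
          mul_le_mul_of_nonneg_left (hf a b) (mul_nonneg (hnn a) (hnn b))
    _ = 2 ^ Fintype.card κ * B := by
        simp only [← Finset.sum_mul, ← Finset.mul_sum, sum_prod_eq_one hδ]
        ring

/-- A tail bound for the expected number of changes, from an exponential moment of the number of
changes. -/
theorem sum_tail_le (hδ0 : ∀ a, 0 ≤ δ a) (hδ : ∑ a, δ a = 1) {u B : ℝ} (hu : 1 ≤ u)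
    (f : (κ → α) → Bool)
    (hB : ∑ a : κ → α, ∑ b : κ → α, (∏ i, δ (a i)) * (∏ i, δ (b i)) * u ^ (changeSet f a b).card
      ≤ B) (t : ℝ) (E : Finset (κ → α))
    (hE : ∀ x ∈ E, t ≤ ∑ i, ∑ w, δ w * if f x ≠ f (Function.update x i w) then 1 else 0) :
    ∑ x ∈ E, ∏ i, δ (x i) ≤ B * u ^ (-t) := by
  have hu0 : 0 < u := by linarith
  have hnn : ∀ a : κ → α, 0 ≤ ∏ i, δ (a i) := fun a => Finset.prod_nonneg fun i _ => hδ0 _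
  -- By linearity, resampling one coordinate at a time has the same total as the mean of `changeSet`
  -- over a full independent sample `b`.
  have hmean : ∀ x : κ → α,
      ∑ i, ∑ w, δ w * (if f x ≠ f (Function.update x i w) then (1 : ℝ) else 0)
        = ∑ b : κ → α, (∏ i, δ (b i)) * ((changeSet f x b).card : ℝ) := by
    intro x
    have : ∀ b : κ → α, ((changeSet f x b).card : ℝ)
        = ∑ i, if f x ≠ f (Function.update x i (b i)) then (1 : ℝ) else 0 := by
      intro b
      rw [changeSet, Finset.sum_boole]
    simp only [this, Finset.mul_sum]
    conv_rhs => rw [Finset.sum_comm]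
    refine Finset.sum_congr rfl fun i _ => ?_
    exact (sum_prod_mul_apply hδ i fun w =>
      if f x ≠ f (Function.update x i w) then (1 : ℝ) else 0).symm
  have hconv : ConvexOn ℝ Set.univ fun t : ℝ => u ^ t := by
    have h1 := convexOn_exp.comp_linearMap (LinearMap.lsmul ℝ ℝ (Real.log u))
    have h2 : (Real.exp ∘ (LinearMap.lsmul ℝ ℝ (Real.log u))) = fun t : ℝ => u ^ t := by
      funext t
      simp [Real.rpow_def_of_pos hu0]
    rwa [h2, Set.preimage_univ] at h1
  -- Jensen in `b` turns the joint moment into one of the conditional mean; Markov's inequality in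
  -- `x` then finishes.
  have hjen : ∀ x : κ → α, u ^ (∑ b : κ → α, (∏ i, δ (b i)) * ((changeSet f x b).card : ℝ))
      ≤ ∑ b : κ → α, (∏ i, δ (b i)) * u ^ (changeSet f x b).card := by
    intro x
    have := hconv.map_sum_le (t := Finset.univ) (w := fun b : κ → α => ∏ i, δ (b i))
      (p := fun b => ((changeSet f x b).card : ℝ)) (fun b _ => hnn b) (sum_prod_eq_one hδ)
      fun _ _ => Set.mem_univ _
    simpa only [smul_eq_mul, Real.rpow_natCast] using this
  have hone : ∀ x ∈ E, u ^ t ≤ ∑ b : κ → α, (∏ i, δ (b i)) * u ^ (changeSet f x b).card :=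
    fun x hx => (Real.rpow_le_rpow_of_exponent_le hu ((hmean x) ▸ hE x hx)).trans (hjen x)
  have hpos : 0 < u ^ t := Real.rpow_pos_of_pos hu0 t
  rw [Real.rpow_neg hu0.le, ← div_eq_mul_inv, le_div_iff₀ hpos, Finset.sum_mul]
  refine le_trans (Finset.sum_le_sum fun x hx => mul_le_mul_of_nonneg_left (hone x hx) (hnn x)) ?_
  refine le_trans (Finset.sum_le_univ_sum_of_nonneg fun x => mul_nonneg (hnn x)
    (Finset.sum_nonneg fun b _ => mul_nonneg (hnn b) (by positivity))) ?_
  simpa only [Finset.mul_sum, mul_assoc] using hB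

end Product

/-! ### Measures as finite sums, and the conclusion. -/

theorem PMF.sum_toReal {α : Type} [Fintype α] (D : PMF α) : ∑ a, (D a).toReal = 1 := by
  have h := D.tsum_coe
  rw [tsum_fintype] at h
  rw [← ENNReal.toReal_sum fun a _ => D.apply_ne_top a, h, ENNReal.toReal_one]

theorem rowsLaw_real (K : ℕ) {M : ℕ} (D : PMF (Fin M → Bool)) (E : Finset (Fin K → Fin M → Bool)) :
    (rowsLaw K D).real (E : Set (Fin K → Fin M → Bool)) = ∑ x ∈ E, ∏ i, (D (x i)).toReal := by
  have : IsProbabilityMeasure (rowsLaw K D) := by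
    unfold rowsLaw
    infer_instance
  rw [← sum_measureReal_singleton]
  refine Finset.sum_congr rfl fun x _ => ?_
  rw [Measure.real, rowsLaw, Measure.pi_singleton, ENNReal.toReal_prod]
  refine Finset.prod_congr rfl fun i _ => ?_
  rw [PMF.toMeasure_apply_singleton _ _ (measurableSet_singleton _)]

theorem resampleRow_real {K M : ℕ} [NeZero K] (D : PMF (Fin M → Bool)) (x : Fin K → Fin M → Bool)
    (q : (Fin K → Fin M → Bool) → Prop) [DecidablePred q] :
    (resampleRow D x).toMeasure.real {y | q y}
      = (∑ i, ∑ w, (D w).toReal * if q (Function.update x i w) then 1 else 0) / K := by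
  classical
  have hm : ∀ A : Set (Fin K → Fin M → Bool), MeasurableSet A := fun A => A.toFinite.measurableSet
  have hm' : ∀ A : Set (Fin M → Bool), MeasurableSet A := fun A => A.toFinite.measurableSet
  rw [Measure.real, resampleRow, PMF.toMeasure_bind_apply _ _ _ (hm _), tsum_fintype,
    ENNReal.toReal_sum]
  · rw [Finset.sum_div]
    refine Finset.sum_congr rfl fun i _ => ?_
    rw [PMF.toMeasure_map_apply _ _ _ (fun _ _ => hm' _) (hm _), ENNReal.toReal_mul,
      PMF.uniformOfFintype_apply, PMF.toMeasure_apply_fintype, ENNReal.toReal_sum]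
    · rw [Fintype.card_fin, ENNReal.toReal_inv, ENNReal.toReal_natCast, mul_comm, ← div_eq_mul_inv]
      congr 1
      refine Finset.sum_congr rfl fun w _ => ?_
      simp only [Set.indicator_apply, Set.mem_preimage, Set.mem_ofPred_eq]
      split_ifs <;> simp
    · intro w _
      rw [Set.indicator_apply]
      split_ifs
      · exact D.apply_ne_top w
      · exact ENNReal.zero_ne_top
  · intro i _
    exact ENNReal.mul_ne_top (PMF.apply_ne_top _ _) (measure_ne_top _ _)

theorem mainTheorem2 :
    ∃ C : ℝ, 0 < C ∧
      ∀ (s d K M : ℕ) [NeZero K], 2 ≤ s → 1 ≤ d →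
      ∀ f : (Fin K × Fin M → Bool) → Bool, f ∈ AC0 (Fin K × Fin M) s d →
      ∀ (D : PMF (Fin M → Bool)) (p : ℝ), 0 < p →
        (rowsLaw K D).real
            {x | p ≤ (resampleRow D x).toMeasure.real
              {y | f (Function.uncurry x) ≠ f (Function.uncurry y)}}
          ≤ 4 * (K : ℝ) / p *
            (2 : ℝ) ^ (-(p * (K : ℝ) / (C * Real.logb 2 (s : ℝ)) ^ (d - 1))) := by
  classical
  refine ⟨2048, by norm_num, fun s d K M _ hs hd f hf D p hp => ?_⟩
  obtain ⟨c, hsize, hdepth, hfc⟩ := hf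
  have hK : (1 : ℝ) ≤ K := by exact_mod_cast Nat.one_le_iff_ne_zero.2 (NeZero.ne K)
  have hK0 : (0 : ℝ) < K := by linarith
  have hs' : (2 : ℝ) ≤ s := by exact_mod_cast hs
  have hell : 1 ≤ Real.logb 2 s := by
    rw [Real.le_logb_iff_rpow_le (by norm_num) (by linarith), Real.rpow_one]
    exact hs'
  set Q : ℝ := (1 / (2048 * Real.logb 2 s)) ^ (d - 1) with hQ
  have hQ0 : 0 ≤ Q := by positivity
  have hQ1 : Q ≤ 1 := by
    refine pow_le_one₀ (by positivity) ?_
    rw [div_le_one (by positivity)]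
    linarith
  set g : (Fin K → Fin M → Bool) → Bool := fun x => f (Function.uncurry x) with hg
  have hδ0 : ∀ a, 0 ≤ (D a).toReal := fun a => ENNReal.toReal_nonneg
  have hδ := D.sum_toReal
  have hmom : ∀ a b : Fin K → Fin M → Bool, ∑ z : Fin K → Bool,
      (1 + Q) ^ (sensitiveSet (fun z => g (mix z a b)) z).card ≤ 4 * 2 ^ Fintype.card (Fin K) := by
    intro a b
    -- For fixed `a` and `b`, each entry of the mixed matrix depends only on the bit of `z` for its
    -- row.
    have hcirc := c.sum_pow_sensitiveSet_le hs hd hsize hdepth (Prod.fst : Fin K × Fin M → Fin K)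
      fun q t => if t then b q.1 q.2 else a q.1 q.2
    have hgz : (fun z : Fin K → Bool => g (mix z a b)) = fun z : Fin K → Bool =>
        c.eval fun q : Fin K × Fin M => if z q.1 then b q.1 q.2 else a q.1 q.2 := by
      funext z
      rw [hg]
      dsimp only
      rw [hfc]
      congr 1
      funext q
      simp only [Function.uncurry, mix]
      split_ifs <;> rfl
    rw [hgz]
    exact hcirc
  set E : Finset (Fin K → Fin M → Bool) := Finset.univ.filter fun x =>
    p ≤ (resampleRow D x).toMeasure.real {y | g x ≠ g y} with hEdef
  have hset : {x | p ≤ (resampleRow D x).toMeasure.real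
      {y | f (Function.uncurry x) ≠ f (Function.uncurry y)}} = (E : Set _) := by
    ext x
    simp [hEdef, hg]
  rw [hset, rowsLaw_real]
  have hE : ∀ x ∈ E, p * K ≤
      ∑ i, ∑ w, (D w).toReal * if g x ≠ g (Function.update x i w) then 1 else 0 := by
    intro x hx
    have := (Finset.mem_filter.1 hx).2
    rwa [resampleRow_real D x fun y => g x ≠ g y, le_div_iff₀ hK0] at this
  -- The argument gives the prefactor 4, and p ≤ 1 ≤ K yields 4 ≤ 4K/p. For p > 1 the event is
  -- empty.
  rcases le_or_gt p 1 with hp1 | hp1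
  · have hB := sum_pow_changeSet_le hδ0 hδ g hmom
    have htail := sum_tail_le hδ0 hδ (by linarith : 1 ≤ 1 + Q) g hB (p * K) E hE
    refine htail.trans (mul_le_mul ?_ ?_ (by positivity) (by positivity))
    · rw [le_div_iff₀ hp]
      nlinarith
    -- Bernoulli's inequality for exponents in [0, 1] converts the base 1 + Q into a power of 2.
    · have h2 : (2 : ℝ) ^ Q ≤ 1 + Q := by
        have := rpow_one_add_le_one_add_mul_self (s := 1) (by norm_num) hQ0 hQ1
        rwa [one_add_one_eq_two, mul_one] at this
      have hexp : p * K / (2048 * Real.logb 2 s) ^ (d - 1) = Q * (p * K) := by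
        rw [hQ, div_pow, one_pow]
        ring
      rw [hexp, Real.rpow_neg (by positivity), Real.rpow_neg (by positivity),
        Real.rpow_mul (show (0 : ℝ) ≤ 2 by norm_num)]
      exact inv_anti₀ (by positivity) (Real.rpow_le_rpow (by positivity) h2 (by positivity))
  · have hempty : E = ∅ := by
      rw [Finset.eq_empty_iff_forall_notMem]
      intro x hx
      have := (Finset.mem_filter.1 hx).2
      have h1 : (resampleRow D x).toMeasure.real {y | g x ≠ g y} ≤ 1 := measureReal_le_one
      linarith
    rw [hempty, Finset.sum_empty]
    positivity
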